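/- Let $\mathcal H=L^2(\mathbb R)$ be the Hilbert space of one harmonic oscillator mode, with position operator $x$, momentum operator $p=-i\,\frac{d}{dx}$ and annihilation operator $a=(x+ip)/\sqrt2$; a state is a positive trace class operator on $\mathcal H$ of unit trace. For a positive self-adjoint operator $A$ and a state $\rho=\sum_i p_i|e_i\rangle\langle e_i|$ (spectral decomposition) put $\operatorname{Tr}[\rho A]=\sum_{p_i>0}p_i\|A^{1/2}e_i\|^2\in[0,\infty]$, where $\|A^{1/2}e_i\|=\infty$ if $e_i\notin\operatorname{dom}(A^{1/2})$. For a self-adjoint operator $X$ with positive and negative parts $X_\pm$ put $\operatorname{Tr}[\rho X]=\operatorname{Tr}[\rho X_+]-\operatorname{Tr}[\rho X_-]$ if both terms are finite. A state $\rho$ is centred if $x$ and $p$ have finite expected value on $\rho$ and $\operatorname{Tr}[\rho x]=\operatorname{Tr}[\rho p]=0$. For real $k$ put $M_k(\rho)=\operatorname{Tr}\big[\rho\,(aa^\dagger)^{k/2}\big]\in[0,\infty]$. For $\lambda\in[0,1]$ let $U_\lambda=\exp\big[\arccos\sqrt\lambda\,(a^\dagger b-ab^\dagger)\big]$ be the beam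 splitter of transmissivity $\lambda$ on $\mathcal H\otimes\mathcal H=L^2(\mathbb R^2)$, where $a,b$ are the annihilation operators of the two modes, and put $\rho\boxplus_\lambda\sigma=\operatorname{Tr}_2\big[U_\lambda(\rho\otimes\sigma)U_\lambda^\dagger\big]$. The symmetric convolutions of $\rho$ are defined by $\rho^{\boxplus1}=\rho$ and $\rho^{\boxplus n}=\rho^{\boxplus(n-1)}\boxplus_{1-1/n}\rho$ for $n\ge2$. Proposition. Let $f(x)=\frac{1}{\sqrt2}\,(1+x^2)^{-3/4}$, and let $\psi_f=|f\rangle\langle f|$. Then $\psi_f$ and all $\psi_f^{\boxplus n}$, $n\ge1$, are states, and: (a) $\psi_f$ is centred; (b) $M_{2(1-\delta)}(\psi_f)=\langle f|(aa^\dagger)^{1-\delta}|f\rangle<\infty$ for every $\delta>0$; (c) the sequence $(\psi_f^{\boxplus n})_{n\ge1}$ does not converge to any state, not even in the weak operator topology: there is no state $\sigma$ with $\langle\varphi|\psi_f^{\boxplus n}|\psi\rangle\to\langle\varphi|\sigma|\psi\rangle$ for all $\varphi,\psi\in\mathcal H$. Hence finiteness of second moments in the Cushen--Hudson quantum central limit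 theorem (for a centred state $\rho$ with finite second moments, $\rho^{\boxplus n}$ converges to a Gaussian state) cannot be weakened to finiteness of all lower moments: it is not true that for every centred one-mode state $\rho$ with $M_k(\rho)<\infty$ for all $k<2$ the sequence $(\rho^{\boxplus n})_{n\ge 1}$ converges, in the weak operator topology, to some state. -/

import Mathlib

open MeasureTheory Filter Topology
open scoped ENNReal InnerProductSpace TensorProduct FourierTransform

noncomputable section

namespace QCLT

/-- The Hilbert space `L²(ℝ)` of one mode. -/
abbrev OneMode : Type := Lp ℂ 2 (volume : Measure ℝ)

/-- The Hilbert space `L²(ℝ²)` of two modes, with wave functions `F (x, y)`. -/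
abbrev TwoMode : Type := Lp ℂ 2 (volume : Measure (ℝ × ℝ))

/-- Density operators: positive operators of unit trace. The trace of a positive operator is the
sum of its diagonal matrix elements in any orthonormal basis. -/
def IsState (ρ : OneMode →L[ℂ] OneMode) : Prop :=
  ρ.IsPositive ∧ ∀ (ι : Type) (b : HilbertBasis ι ℂ OneMode), HasSum (fun i => ⟪b i, ρ (b i)⟫_ℂ) 1

/-- The rank-one operator `|ψ⟩⟨ψ|`. -/
def pureState (ψ : OneMode) : OneMode →L[ℂ] OneMode := InnerProductSpace.rankOne ℂ ψ ψ

/-! ### Product wave functions and product operators -/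

theorem memLp_prodFun (f g : OneMode) :
    MemLp (fun p : ℝ × ℝ => f p.1 * g p.2) 2 (volume : Measure (ℝ × ℝ)) := by
  have hf := Lp.memLp f
  have hg := Lp.memLp g
  have hm : AEStronglyMeasurable (fun p : ℝ × ℝ => f p.1 * g p.2) (volume : Measure (ℝ × ℝ)) :=
    (hf.1.comp_fst).mul (hg.1.comp_snd)
  rw [memLp_two_iff_integrable_sq_norm hm]
  have := ((memLp_two_iff_integrable_sq_norm hf.1).1 hf).mul_prod
    ((memLp_two_iff_integrable_sq_norm hg.1).1 hg)
  refine this.congr (Eventually.of_forall fun p => ?_)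
  simp [mul_pow]

/-- The product wave function `(x, y) ↦ f x * g y`. -/
def prodVec (f g : OneMode) : TwoMode := (memLp_prodFun f g).toLp

theorem coeFn_prodVec (f g : OneMode) :
    prodVec f g =ᵐ[volume] fun p : ℝ × ℝ => f p.1 * g p.2 := (memLp_prodFun f g).coeFn_toLp

theorem ae_fst {P : ℝ → Prop} (h : ∀ᵐ x, P x) : ∀ᵐ p : ℝ × ℝ, P p.1 :=
  Measure.quasiMeasurePreserving_fst.ae h

theorem ae_snd {P : ℝ → Prop} (h : ∀ᵐ x, P x) : ∀ᵐ p : ℝ × ℝ, P p.2 :=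
  Measure.quasiMeasurePreserving_snd.ae h

theorem inner_prodVec (f g f' g' : OneMode) :
    ⟪prodVec f g, prodVec f' g'⟫_ℂ = ⟪f, f'⟫_ℂ * ⟪g, g'⟫_ℂ := by
  rw [L2.inner_def, L2.inner_def, L2.inner_def]
  rw [← integral_prod_mul]
  refine integral_congr_ae ?_
  filter_upwards [coeFn_prodVec f g, coeFn_prodVec f' g'] with p h1 h2
  rw [h1, h2]
  simp only [RCLike.inner_apply, map_mul]
  ring

/-- `f ⊗ g ↦ prodVec f g` as a bilinear map. -/
def prodVecBilin : OneMode →ₗ[ℂ] OneMode →ₗ[ℂ] TwoMode :=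
  LinearMap.mk₂ ℂ prodVec
    (fun f f' g => by
      refine Lp.ext ?_
      filter_upwards [coeFn_prodVec (f + f') g, coeFn_prodVec f g, coeFn_prodVec f' g,
        Lp.coeFn_add (prodVec f g) (prodVec f' g), ae_fst (Lp.coeFn_add f f')] with p h1 h2 h3 h4 h5
      rw [h1, h4, Pi.add_apply, h2, h3, h5, Pi.add_apply, add_mul])
    (fun c f g => by
      refine Lp.ext ?_
      filter_upwards [coeFn_prodVec (c • f) g, coeFn_prodVec f g,
        Lp.coeFn_smul c (prodVec f g), ae_fst (Lp.coeFn_smul c f)] with p h1 h2 h3 h4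
      rw [h1, h3, Pi.smul_apply, h2, h4, Pi.smul_apply, smul_mul_assoc])
    (fun f g g' => by
      refine Lp.ext ?_
      filter_upwards [coeFn_prodVec f (g + g'), coeFn_prodVec f g, coeFn_prodVec f g',
        Lp.coeFn_add (prodVec f g) (prodVec f g'), ae_snd (Lp.coeFn_add g g')] with p h1 h2 h3 h4 h5
      rw [h1, h4, Pi.add_apply, h2, h3, h5, Pi.add_apply, mul_add])
    (fun c f g => by
      refine Lp.ext ?_
      filter_upwards [coeFn_prodVec f (c • g), coeFn_prodVec f g,
        Lp.coeFn_smul c (prodVec f g), ae_snd (Lp.coeFn_smul c g)] with p h1 h2 h3 h4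
      rw [h1, h3, Pi.smul_apply, h2, h4, Pi.smul_apply, mul_smul_comm])

/-- The isometric embedding of the algebraic tensor product `L²(ℝ) ⊗ L²(ℝ)` into `L²(ℝ²)`. -/
def prodEmb : OneMode ⊗[ℂ] OneMode →ₗᵢ[ℂ] TwoMode :=
  (TensorProduct.lift prodVecBilin).isometryOfInner (by
    intro x y
    induction x using TensorProduct.induction_on with
    | zero => simp
    | add x x' hx hx' => simp only [map_add, inner_add_left, hx, hx']
    | tmul f g =>
      induction y using TensorProduct.induction_on with
      | zero => simp
      | add y y' hy hy' => simp only [map_add, inner_add_right, hy, hy']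
      | tmul f' g' =>
        simp only [TensorProduct.lift.tmul, TensorProduct.inner_tmul]
        exact inner_prodVec f g f' g')

theorem prodEmb_tmul (f g : OneMode) : prodEmb (f ⊗ₜ[ℂ] g) = prodVec f g := rfl

theorem eq_zero_of_forall_inner_prodVec (F : TwoMode) (h : ∀ f g, ⟪prodVec f g, F⟫_ℂ = 0) :
    F = 0 := by
  have hrect : ∀ A B : Set ℝ, MeasurableSet A → MeasurableSet B → volume A ≠ ∞ → volume B ≠ ∞ →
      ∫ p in A ×ˢ B, F p = 0 := by
    intro A B hA hB hA' hB'
    have := h (indicatorConstLp 2 hA hA' (1 : ℂ)) (indicatorConstLp 2 hB hB' (1 : ℂ))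
    rw [L2.inner_def] at this
    rw [← integral_indicator (hA.prod hB), ← this]
    refine integral_congr_ae ?_
    filter_upwards [coeFn_prodVec (indicatorConstLp 2 hA hA' (1 : ℂ))
      (indicatorConstLp 2 hB hB' (1 : ℂ)),
      ae_fst (indicatorConstLp_coeFn (p := 2) (hs := hA) (hμs := hA') (c := (1 : ℂ))),
      ae_snd (indicatorConstLp_coeFn (p := 2) (hs := hB) (hμs := hB') (c := (1 : ℂ)))]
      with p h1 h2 h3
    rw [h1, h2, h3]
    by_cases ha : p.1 ∈ A <;> by_cases hb : p.2 ∈ B <;>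
      simp [Set.indicator, Set.mem_prod, ha, hb]
  let S : ℕ → Set (ℝ × ℝ) := fun n => Set.Icc (-(n : ℝ)) n ×ˢ Set.Icc (-(n : ℝ)) n
  have hS : ∀ n, MeasurableSet (S n) := fun n => measurableSet_Icc.prod measurableSet_Icc
  have hfin : ∀ n, volume (S n) ≠ ∞ := fun n =>
    (isCompact_Icc.prod isCompact_Icc).measure_lt_top.ne
  have hae : ∀ n, ∀ᵐ p ∂(volume.restrict (S n)), F p = 0 := by
    intro n
    have : IsFiniteMeasure (volume.restrict (S n)) := ⟨by
      rw [Measure.restrict_apply_univ]; exact (hfin n).lt_top⟩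
    have hint : Integrable F (volume.restrict (S n)) :=
      ((Lp.memLp F).restrict (S n)).integrable one_le_two
    refine hint.ae_eq_zero_of_forall_setIntegral_eq_zero ?_
    intro s hs _
    induction s, hs using MeasurableSpace.induction_on_inter generateFrom_prod.symm
      isPiSystem_prod with
    | empty => simp
    | basic t ht =>
      obtain ⟨A, hA, B, hB, rfl⟩ := ht
      rw [Set.mem_ofPred_eq] at hA hB
      rw [Measure.restrict_restrict (hA.prod hB), Set.prod_inter_prod]
      refine hrect _ _ (MeasurableSet.inter hA measurableSet_Icc)
        (MeasurableSet.inter hB measurableSet_Icc) ?_ ?_ <;>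
      exact ((measure_mono Set.inter_subset_right).trans_lt isCompact_Icc.measure_lt_top).ne
    | compl t htm ih =>
      have h0 : ∫ p, F p ∂(volume.restrict (S n)) = 0 :=
        hrect _ _ measurableSet_Icc measurableSet_Icc isCompact_Icc.measure_lt_top.ne
          isCompact_Icc.measure_lt_top.ne
      have := integral_add_compl htm hint
      rw [ih (measure_lt_top _ _), h0, zero_add] at this
      exact this
    | iUnion f hd hm ih =>
      rw [integral_iUnion hm hd hint.integrableOn]
      simp [fun i => ih i (measure_lt_top _ _)]
  have hcov : (⋃ n, S n) = Set.univ := by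
    refine Set.eq_univ_of_forall fun p => ?_
    obtain ⟨n, hn⟩ := exists_nat_ge (max |p.1| |p.2|)
    refine Set.mem_iUnion.2 ⟨n, ?_⟩
    exact ⟨abs_le.1 ((le_max_left _ _).trans hn), abs_le.1 ((le_max_right _ _).trans hn)⟩
  refine Lp.ext ?_
  have h1 : ∀ᵐ p ∂(volume.restrict (⋃ n, S n)), F p = 0 := ae_restrict_iUnion_iff _ _ |>.2 hae
  rw [hcov, Measure.restrict_univ] at h1
  filter_upwards [h1, Lp.coeFn_zero ℂ 2 (volume : Measure (ℝ × ℝ))] with p hp hp'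
  rw [hp, hp', Pi.zero_apply]

theorem denseRange_prodEmb : DenseRange prodEmb := by
  have : (LinearMap.range prodEmb.toLinearMap).topologicalClosure = ⊤ := by
    rw [Submodule.topologicalClosure_eq_top_iff, Submodule.eq_bot_iff]
    intro F hF
    refine eq_zero_of_forall_inner_prodVec F fun f g => ?_
    exact (Submodule.mem_orthogonal _ _).1 hF _ ⟨f ⊗ₜ[ℂ] g, rfl⟩
  have h2 := (Submodule.dense_iff_topologicalClosure_eq_top).2 this
  exact h2

/-- The operator `ρ ⊗ σ` on `L²(ℝ²)`: the bounded operator with `f ⊗ g ↦ ρ f ⊗ σ g`. -/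
def tensorOp (ρ σ : OneMode →L[ℂ] OneMode) : TwoMode →L[ℂ] TwoMode :=
  (prodEmb.toContinuousLinearMap ∘L TensorProduct.mapL ρ σ).extend prodEmb.toContinuousLinearMap

theorem tensorOp_prodVec (ρ σ : OneMode →L[ℂ] OneMode) (f g : OneMode) :
    tensorOp ρ σ (prodVec f g) = prodVec (ρ f) (σ g) :=
  ContinuousLinearMap.extend_eq (e := prodEmb.toContinuousLinearMap)
    (prodEmb.toContinuousLinearMap ∘L TensorProduct.mapL ρ σ) denseRange_prodEmb
    prodEmb.isometry.isUniformInducing (f ⊗ₜ[ℂ] g)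

/-- For a vector `g` of the second mode, the operator `I ⊗ |g⟩ : f ↦ f ⊗ g`. Its adjoint is
the partial contraction `I ⊗ ⟨g|`. -/
def tensorRight (g : OneMode) : OneMode →L[ℂ] TwoMode :=
  prodEmb.toContinuousLinearMap ∘L (TensorProduct.mkL ℂ OneMode OneMode).flip g

theorem tensorRight_apply (f g : OneMode) : tensorRight g f = prodVec f g := rfl

/-- Some orthonormal basis of `L²(ℝ)`. -/
def someBasis : HilbertBasis (exists_hilbertBasis ℂ OneMode).choose ℂ OneMode :=
  (exists_hilbertBasis ℂ OneMode).choose_spec.choose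

/-- The partial trace over the second mode, `Tr₂ T = ∑ₖ (I ⊗ ⟨bₖ|) T (I ⊗ |bₖ⟩)`. For trace class
`T` the sum converges absolutely in operator norm and does not depend on the basis. -/
def partialTrace (T : TwoMode →L[ℂ] TwoMode) : OneMode →L[ℂ] OneMode :=
  ∑' k, (tensorRight (someBasis k)).adjoint ∘L T ∘L tensorRight (someBasis k)

/-! ### Beam splitters and quantum convolution -/

/-- The rotation `(x, y) ↦ (cos θ x - sin θ y, sin θ x + cos θ y)`. -/
def rotation (θ : ℝ) : ℝ × ℝ →ₗ[ℝ] ℝ × ℝ where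
  toFun p := (Real.cos θ * p.1 - Real.sin θ * p.2, Real.sin θ * p.1 + Real.cos θ * p.2)
  map_add' p q := by ext <;> simp <;> ring
  map_smul' c p := by ext <;> simp <;> ring

theorem det_rotation (θ : ℝ) : LinearMap.det (rotation θ) = 1 := by
  rw [← LinearMap.det_toMatrix (Module.Basis.finTwoProd ℝ), Matrix.det_fin_two]
  simp [LinearMap.toMatrix_apply, rotation]
  nlinarith [Real.sin_sq_add_cos_sq θ]

theorem measurePreserving_rotation (θ : ℝ) :
    MeasurePreserving (rotation θ) (volume : Measure (ℝ × ℝ)) volume := by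
  refine ⟨(rotation θ).continuous_of_finiteDimensional.measurable, ?_⟩
  have : (volume : Measure (ℝ × ℝ)).IsAddHaarMeasure := by
    rw [Measure.volume_eq_prod]; infer_instance
  rw [Measure.map_linearMap_addHaar_eq_smul_addHaar _ (by rw [det_rotation]; exact one_ne_zero),
    det_rotation]
  simp

/-- The beam splitter of transmissivity `lam`, `U = exp (arccos √lam * (a† b - a b†))`.
Since `a = (x + ∂ₓ) / √2` and `b = (y + ∂_y) / √2`, one has `a† b - a b† = x ∂_y - y ∂ₓ`, and the
one-parameter unitary group `exp (θ (x ∂_y - y ∂ₓ))` is composition with `rotation θ`.  In this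
way `U a U† = √lam a - √(1 - lam) b` and `U b U† = √(1 - lam) a + √lam b`. -/
def beamSplitter (lam : ℝ) : TwoMode →L[ℂ] TwoMode :=
  (Lp.compMeasurePreservingₗᵢ ℂ (rotation (Real.arccos (Real.sqrt lam)))
    (measurePreserving_rotation _)).toContinuousLinearMap

/-- The quantum convolution `ρ ⊞_lam σ = Tr₂ [U (ρ ⊗ σ) U†]`. -/
def conv (lam : ℝ) (ρ σ : OneMode →L[ℂ] OneMode) : OneMode →L[ℂ] OneMode :=
  partialTrace (beamSplitter lam ∘L tensorOp ρ σ ∘L (beamSplitter lam).adjoint)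

/-- The symmetric convolution `ρ^{⊞ n}` for `n ≥ 1`, with
`ρ^{⊞ 1} = ρ` and `ρ^{⊞ n} = ρ^{⊞ (n-1)} ⊞_{1 - 1/n} ρ`; the value at `n = 0` is not used. -/
def convPow (ρ : OneMode →L[ℂ] OneMode) : ℕ → (OneMode →L[ℂ] OneMode)
  | 0 => 0
  | 1 => ρ
  | n + 2 => conv (1 - 1 / ((n : ℝ) + 2)) (convPow ρ (n + 1)) ρ

/-- Convergence in the weak operator topology. For a sequence of states and a limit that is a
state it is equivalent to weak convergence and to convergence in trace norm. -/
def ConvergesWeakly (ρ : ℕ → (OneMode →L[ℂ] OneMode)) (σ : OneMode →L[ℂ] OneMode) : Prop :=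
  ∀ φ ψ : OneMode, Tendsto (fun n => ⟪φ, ρ n ψ⟫_ℂ) atTop (𝓝 ⟪φ, σ ψ⟫_ℂ)

/-! ### Expected values, first moments and the moments of `a a†` -/

/-- A spectral decomposition `ρ = ∑ᵢ pᵢ |eᵢ⟩⟨eᵢ|` along an orthonormal basis of eigenvectors. -/
structure SpectralDecomposition (ρ : OneMode →L[ℂ] OneMode) where
  /-- the index set -/
  ι : Type
  /-- the eigenvectors -/
  e : HilbertBasis ι ℂ OneMode
  /-- the eigenvalues -/
  p : ι → ℝ
  eigen : ∀ i, ρ (e i) = (p i : ℂ) • e i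

/-- The expected value `Tr [ρ A] = ∑_{pᵢ > 0} pᵢ ‖A^{1/2} eᵢ‖²` on a state `ρ` of a positive
self-adjoint operator `A`, given through `q ψ = ‖A^{1/2} ψ‖²`, with `q ψ = ∞` outside the domain of
`A^{1/2}`. The sum is the same for all spectral decompositions of `ρ`. -/
def expected (q : OneMode → ℝ≥0∞) (ρ : OneMode →L[ℂ] OneMode) : ℝ≥0∞ :=
  ⨅ d : SpectralDecomposition ρ, ∑' i, ENNReal.ofReal (d.p i) * q (d.e i)

/-- `‖X₊^{1/2} ψ‖²` for `X = s x`, where `x` is the position operator. -/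
def positionPart (s : ℝ) (ψ : OneMode) : ℝ≥0∞ :=
  ∫⁻ x : ℝ, ENNReal.ofReal (s * x) * ‖ψ x‖ₑ ^ 2

/-- `‖X₊^{1/2} ψ‖²` for `X = s p`, where `p = -i d/dx` is the momentum operator, which is
multiplication by `2 π ξ` after the Fourier transform. -/
def momentumPart (s : ℝ) (ψ : OneMode) : ℝ≥0∞ :=
  ∫⁻ ξ : ℝ, ENNReal.ofReal (s * (2 * Real.pi * ξ)) * ‖(𝓕 ψ : OneMode) ξ‖ₑ ^ 2

/-- `ρ` is centred: `x` and `p` have finite expected value on `ρ`, equal to `0`. The positive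
and negative parts of `X` are the positive parts of `X` and of `-X`. -/
structure IsCentred (ρ : OneMode →L[ℂ] OneMode) : Prop where
  position_lt_top : ∀ s ∈ ({1, -1} : Set ℝ), expected (positionPart s) ρ < ∞
  momentum_lt_top : ∀ s ∈ ({1, -1} : Set ℝ), expected (momentumPart s) ρ < ∞
  position_zero :
    (expected (positionPart 1) ρ).toReal - (expected (positionPart (-1)) ρ).toReal = 0
  momentum_zero :
    (expected (momentumPart 1) ρ).toReal - (expected (momentumPart (-1)) ρ).toReal = 0

/-- The annihilation operator `a = (x + i p) / √2 = (x + d/dx) / √2` on differentiable functions. -/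
def annihilation (g : ℝ → ℝ) (x : ℝ) : ℝ := (x * g x + deriv g x) / Real.sqrt 2

/-- The creation operator `a† = (x - i p) / √2 = (x - d/dx) / √2` on differentiable functions. -/
def creation (g : ℝ → ℝ) (x : ℝ) : ℝ := (x * g x - deriv g x) / Real.sqrt 2

/-- The wave function of the Fock state `|n⟩ = (n!)^{-1/2} (a†)^n |0⟩`, where
`|0⟩` has the wave function `π^{-1/4} exp (-x²/2)`. These are an orthonormal basis of `L²(ℝ)`. -/
def fock (n : ℕ) (x : ℝ) : ℝ :=
  (Real.sqrt (n.factorial))⁻¹ *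
    creation^[n] (fun y => Real.pi ^ (-(1 / 4) : ℝ) * Real.exp (-y ^ 2 / 2)) x

theorem annihilation_creation {g : ℝ → ℝ} (hg : ContDiff ℝ (⊤ : ℕ∞) g) :
    annihilation (creation g) = creation (annihilation g) + g := by
  have h1 : Differentiable ℝ g := hg.differentiable (by simp)
  have h2 : Differentiable ℝ (deriv g) :=
    ((contDiff_infty_iff_deriv.1 hg).2).differentiable (by simp)
  funext x
  have hx : HasDerivAt (fun y : ℝ => y * g y) (1 * g x + x * deriv g x) x :=
    (hasDerivAt_id x).mul (h1 x).hasDerivAt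
  have hc : deriv (creation g) x = (1 * g x + x * deriv g x - deriv (deriv g) x) / Real.sqrt 2 :=
    ((hx.sub (h2 x).hasDerivAt).div_const _).deriv
  have ha : deriv (annihilation g) x
      = (1 * g x + x * deriv g x + deriv (deriv g) x) / Real.sqrt 2 :=
    ((hx.add (h2 x).hasDerivAt).div_const _).deriv
  simp only [Pi.add_apply]
  rw [annihilation, hc, creation, creation, ha, annihilation]
  have h3 : Real.sqrt 2 ≠ 0 := by positivity
  field_simp
  rw [Real.sq_sqrt zero_le_two]
  ring

theorem contDiff_creation {g : ℝ → ℝ} (hg : ContDiff ℝ (⊤ : ℕ∞) g) :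
    ContDiff ℝ (⊤ : ℕ∞) (creation g) :=
  ((contDiff_id.mul hg).sub (contDiff_infty_iff_deriv.1 hg).2).div_const _

theorem creation_const_mul (c : ℝ) (g : ℝ → ℝ) :
    creation (fun x => c * g x) = fun x => c * creation g x := by
  funext x
  simp only [creation, deriv_const_mul_field']
  ring

theorem annihilation_const_mul (c : ℝ) (g : ℝ → ℝ) :
    annihilation (fun x => c * g x) = fun x => c * annihilation g x := by
  funext x
  simp only [annihilation, deriv_const_mul_field']
  ring

/-- `a a† |n⟩ = (n + 1) |n⟩`. -/
theorem annihilation_creation_fock (n : ℕ) :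
    annihilation (creation (fock n)) = fun x => ((n : ℝ) + 1) * fock n x := by
  set v : ℝ → ℝ := fun y => Real.pi ^ (-(1 / 4) : ℝ) * Real.exp (-y ^ 2 / 2) with hv
  have hsm : ContDiff ℝ (⊤ : ℕ∞) v := by fun_prop
  have hit : ∀ m, ContDiff ℝ (⊤ : ℕ∞) (creation^[m] v) := by
    intro m
    induction m with
    | zero => exact hsm
    | succ m ih => rw [Function.iterate_succ_apply']; exact contDiff_creation ih
  have hvac : annihilation v = fun _ => 0 := by
    funext x
    have : HasDerivAt v (Real.pi ^ (-(1 / 4) : ℝ) * (Real.exp (-x ^ 2 / 2) * -x)) x := by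
      have h1 : HasDerivAt (fun y : ℝ => -y ^ 2 / 2) (-x) x := by
        have := ((hasDerivAt_pow 2 x).neg).div_const 2
        refine this.congr_deriv ?_
        simp
        ring
      exact (h1.exp).const_mul _
    rw [annihilation, this.deriv, hv]
    ring
  have key : ∀ m, annihilation (creation (creation^[m] v))
      = fun x => ((m : ℝ) + 1) * (creation^[m] v) x := by
    intro m
    induction m with
    | zero =>
      funext x
      rw [annihilation_creation (hit 0)]
      simp [hvac, creation]
    | succ m ih =>
      rw [annihilation_creation (hit (m + 1)), Function.iterate_succ_apply', ih,
        creation_const_mul]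
      funext x
      simp
      ring
  have hf : fock n = fun x => (Real.sqrt (n.factorial))⁻¹ * (creation^[n] v) x := rfl
  rw [hf, creation_const_mul, annihilation_const_mul, key]
  funext x
  ring

/-- The number `⟨n|ψ⟩`. -/
def fockCoeff (n : ℕ) (ψ : OneMode) : ℂ := ∫ x : ℝ, (fock n x : ℂ) * ψ x

/-- `‖A^{1/2} ψ‖² = ⟨ψ|A|ψ⟩` for `A = (a a†)^r`. The positive self-adjoint operator
`a a† = a† a + 1` is diagonal in the Fock basis with `a a† |n⟩ = (n + 1) |n⟩`, so that
`(a a†)^r = ∑ₙ (n + 1)^r |n⟩⟨n|`. -/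
def powForm (r : ℝ) (ψ : OneMode) : ℝ≥0∞ :=
  ∑' n : ℕ, ENNReal.ofReal (((n : ℝ) + 1) ^ r) * ‖fockCoeff n ψ‖ₑ ^ 2

/-- The moment `M_k (ρ) = Tr [ρ (a a†)^{k/2}]`. -/
def moment (k : ℝ) (ρ : OneMode →L[ℂ] OneMode) : ℝ≥0∞ := expected (powForm (k / 2)) ρ

/-! ### The wave function -/

/-- `f (x) = 2^{-1/2} (1 + x²)^{-3/4}`. -/
def waveFun (x : ℝ) : ℂ := ((1 / Real.sqrt 2 * (1 / (1 + x ^ 2) ^ (3 / 4 : ℝ)) : ℝ) : ℂ)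

theorem memLp_waveFun : MemLp waveFun 2 (volume : Measure ℝ) := by
  have hc : Continuous waveFun := by
    unfold waveFun
    refine Complex.continuous_ofReal.comp (continuous_const.mul ?_)
    refine continuous_const.div ?_ fun x => ?_
    · exact (by fun_prop : Continuous fun x : ℝ => 1 + x ^ 2).rpow_const
        fun x => Or.inl (by positivity)
    · positivity
  rw [memLp_two_iff_integrable_sq_norm hc.aestronglyMeasurable]
  have := (integrable_rpow_neg_one_add_norm_sq (E := ℝ) (μ := volume) (r := 3)
    (by simp)).const_mul (1 / 2)
  refine this.congr (Eventually.of_forall fun x => ?_)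
  have hx : (0 : ℝ) < 1 + x ^ 2 := by positivity
  have h1 : ((1 + x ^ 2) ^ (3 / 4 : ℝ)) ^ 2 = (1 + x ^ 2) ^ (3 / 2 : ℝ) := by
    rw [← Real.rpow_natCast, ← Real.rpow_mul hx.le]; norm_num
  have h2 : (1 + x ^ 2) ^ (-3 / 2 : ℝ) = ((1 + x ^ 2) ^ (3 / 2 : ℝ))⁻¹ := by
    rw [← Real.rpow_neg hx.le]; norm_num
  simp only [waveFun, Complex.norm_real, Real.norm_eq_abs, sq_abs, mul_pow, h2, one_div,
    inv_pow, h1, Real.sq_sqrt (zero_le_two : (0 : ℝ) ≤ 2)]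

/-- The vector `f` of `L²(ℝ)`. -/
def waveVec : OneMode := memLp_waveFun.toLp

end QCLT

end

noncomputable section

namespace QCLT

/-! ### Parseval's identity -/

/-! The divergence in (c) is already visible in the position distribution. The beam splitter rotates
the plane, so if X and Y are independent with the position laws of ρ and σ, then √λ X + √(1-λ) Y has
the position law of ρ ⊞_λ σ (`positionLaw_convVec`). Hence the position law of ψ_f^{⊞n} is that of
(X₁ + ⋯ + Xₙ)/√n for independent Xᵢ of density |f|² = ½ (1 + x²)^{-3/2}
(`exists_isMixture_convPow_charFun`).

This density is symmetric and has infinite variance, since x²|f|² decays only like 1/|x|. Its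
characteristic function φ is real, and Fatou's lemma gives n(1 - φ(t/√n)) → ∞, so that φ(t/√n)ⁿ → 0
for every t ≠ 0 (`tendsto_charFun_pow`). All mass therefore escapes from every bounded interval
(`tendsto_measure_Icc_of_tendsto_charFun`). A weak limit σ would have ⟨ψ|σ|ψ⟩ = 0 first for ψ of
bounded support and then, by density, for all ψ, which contradicts unit trace
(`not_convergesWeakly_convPow`).

To speak of the position law of a mixed state, states are carried along as sums ∑ |vᵢ⟩⟨vᵢ| with ∑
‖vᵢ‖² = 1 and vᵢ not necessarily orthogonal. Convolution with a pure state preserves this form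
(`IsMixture.conv`), which also shows that all the convolutions are states.

For (b) the divergence of the second moment is only logarithmic, and real interpolation between L²
and the form domain of a a† applies. For each ε the function f is split into a damped part d and a
tail t. Integration by parts and Bessel's inequality bound ∑ (n+1)|⟨n|d⟩|² by ‖a†d‖² = O(ε^{-η}),
while ‖t‖² = O(ε^{1-η}) for any η in (0, 1]. Summing over dyadic ε controls ∑ (n+1)^r |⟨n|f⟩|² for r
< 1. Part (a) is parity together with the decay of f and f′. -/

theorem tsum_enorm_sq_inner {E ι : Type*} [NormedAddCommGroup E] [InnerProductSpace ℂ E]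
    (b : HilbertBasis ι ℂ E) (x : E) : ∑' i, ‖⟪b i, x⟫_ℂ‖ₑ ^ 2 = ‖x‖ₑ ^ 2 := by
  have h := b.hasSum_inner_mul_inner x x
  have h1 : HasSum (fun i => ((‖⟪b i, x⟫_ℂ‖ ^ 2 : ℝ) : ℂ)) ((‖x‖ ^ 2 : ℝ) : ℂ) := by
    convert! h using 1
    · funext i
      rw [← inner_conj_symm x (b i), RCLike.conj_mul]
      simp
    · rw [inner_self_eq_norm_sq_to_K]
      simp
  have h2 := Complex.hasSum_ofReal.1 h1
  have h3 := ENNReal.ofReal_tsum_of_nonneg (fun i => by positivity) h2.summable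
  rw [h2.tsum_eq] at h3
  simpa [ENNReal.ofReal_pow, ofReal_norm] using h3.symm

/-- Allows traces to be computed in `ℝ≥0∞`, where double sums may be exchanged freely. -/
theorem hasSum_of_tsum_enorm_eq {ι : Type*} {z : ι → ℂ} (hz : ∀ i, z i = (‖z i‖ : ℂ))
    (h : ∑' i, ‖z i‖ₑ = 1) : HasSum z 1 := by
  have h1 := ENNReal.hasSum_toReal (f := fun i => ‖z i‖ₑ) (by rw [h]; simp)
  rw [← ENNReal.tsum_toReal_eq (fun i => enorm_ne_top), h] at h1
  have h2 := Complex.hasSum_ofReal.2 h1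
  simp only [toReal_enorm, ENNReal.toReal_one, Complex.ofReal_one] at h2
  convert! h2 using 1
  funext i
  exact hz i

/-! ### Mixtures of pure states -/

/-- `ρ = ∑ᵢ |vᵢ⟩⟨vᵢ|` with `∑ᵢ ‖vᵢ‖² = 1`, where the vectors need not be orthogonal. -/
structure IsMixture (ρ : OneMode →L[ℂ] OneMode) {ι : Type} (v : ι → OneMode) : Prop where
  tsum_enorm_sq : ∑' i, ‖v i‖ₑ ^ 2 = 1
  hasSum : HasSum (fun i => InnerProductSpace.rankOne ℂ (v i) (v i)) ρ

theorem summable_rankOne {E ι : Type*} [NormedAddCommGroup E] [InnerProductSpace ℂ E]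
    [CompleteSpace E] {v : ι → E} (h : ∑' i, ‖v i‖ₑ ^ 2 ≠ ∞) :
    Summable (fun i => InnerProductSpace.rankOne ℂ (v i) (v i)) := by
  refine Summable.of_norm ?_
  have h1 := (ENNReal.hasSum_toReal h).summable
  refine h1.congr fun i => ?_
  simp [pow_two]

theorem isMixture_pureState {ψ : OneMode} (h : ‖ψ‖ = 1) :
    IsMixture (pureState ψ) (fun _ : Unit => ψ) where
  tsum_enorm_sq := by
    rw [tsum_fintype]
    simp [← ofReal_norm, h]
  hasSum := by
    simp [pureState]

namespace IsMixture

variable {ρ : OneMode →L[ℂ] OneMode} {ι : Type} {v : ι → OneMode}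

theorem hasSum_inner (h : IsMixture ρ v) (x : OneMode) :
    HasSum (fun i => ((‖⟪v i, x⟫_ℂ‖ ^ 2 : ℝ) : ℂ)) ⟪x, ρ x⟫_ℂ := by
  have h1 := (h.hasSum.mapL (ContinuousLinearMap.apply ℂ OneMode x)).mapL (innerSL ℂ x)
  convert! h1 using 1
  funext i
  simp only [ContinuousLinearMap.apply_apply, InnerProductSpace.rankOne_apply, map_smul,
    innerSL_apply_apply, smul_eq_mul]
  rw [← inner_conj_symm x (v i), RCLike.mul_conj]
  simp

theorem inner_eq_norm (h : IsMixture ρ v) (x : OneMode) :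
    ⟪x, ρ x⟫_ℂ = (‖⟪x, ρ x⟫_ℂ‖ : ℂ) := by
  have h1 := (h.hasSum_inner x).tsum_eq
  rw [← Complex.ofReal_tsum] at h1
  rw [← h1, Complex.norm_real, Real.norm_of_nonneg (tsum_nonneg fun i => by positivity)]

theorem enorm_inner (h : IsMixture ρ v) (x : OneMode) :
    ‖⟪x, ρ x⟫_ℂ‖ₑ = ∑' i, ‖⟪v i, x⟫_ℂ‖ₑ ^ 2 := by
  have h1 := h.hasSum_inner x
  rw [h.inner_eq_norm] at h1
  have h2 := Complex.hasSum_ofReal.1 h1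
  rw [← ofReal_norm, ← h2.tsum_eq,
    ENNReal.ofReal_tsum_of_nonneg (fun i => by positivity) h2.summable]
  simp [ENNReal.ofReal_pow]

/-- The trace in a basis b is the double sum of |⟨vᵢ, bⱼ⟩|². Summing over j first, Parseval turns it
into ∑ ‖vᵢ‖² = 1. -/
theorem isState (h : IsMixture ρ v) : IsState ρ := by
  constructor
  · rw [ContinuousLinearMap.isPositive_iff_complex]
    intro x
    have h1 : ⟪ρ x, x⟫_ℂ = (‖⟪x, ρ x⟫_ℂ‖ : ℂ) := by
      rw [← inner_conj_symm, h.inner_eq_norm]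
      simp
    rw [h1]
    constructor <;> simp
  · intro κ b
    refine hasSum_of_tsum_enorm_eq (fun j => h.inner_eq_norm _) ?_
    simp_rw [h.enorm_inner]
    rw [ENNReal.tsum_comm, ← h.tsum_enorm_sq]
    refine tsum_congr fun i => ?_
    rw [← tsum_enorm_sq_inner b]
    refine tsum_congr fun j => ?_
    rw [← inner_conj_symm, RCLike.enorm_conj]

end IsMixture

/-! ### Partial contractions -/

theorem inner_adjoint_tensorRight (f g : OneMode) (F : TwoMode) :
    ⟪f, (tensorRight g).adjoint F⟫_ℂ = ⟪prodVec f g, F⟫_ℂ := by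
  rw [ContinuousLinearMap.adjoint_inner_right, tensorRight_apply]

/-- The operator `|f⟩ ⊗ I : g ↦ f ⊗ g`. -/
def tensorLeft (f : OneMode) : OneMode →L[ℂ] TwoMode :=
  prodEmb.toContinuousLinearMap ∘L TensorProduct.mkL ℂ OneMode OneMode f

theorem tensorLeft_apply (f g : OneMode) : tensorLeft f g = prodVec f g := rfl

/-- The products of the elements of an orthonormal basis. -/
def prodBasis {ι : Type*} (b : HilbertBasis ι ℂ OneMode) : HilbertBasis (ι × ι) ℂ TwoMode :=
  HilbertBasis.mkOfOrthogonalEqBot (v := fun p : ι × ι => prodVec (b p.1) (b p.2))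
    (by
      classical
      rw [orthonormal_iff_ite]
      intro p q
      rw [inner_prodVec, orthonormal_iff_ite.1 b.orthonormal, orthonormal_iff_ite.1 b.orthonormal]
      by_cases h1 : p.1 = q.1 <;> by_cases h2 : p.2 = q.2 <;> simp [h1, h2, Prod.ext_iff])
    (by
      rw [Submodule.eq_bot_iff]
      intro F hF
      have h0 : ∀ i j, ⟪prodVec (b i) (b j), F⟫_ℂ = 0 := fun i j =>
        (Submodule.mem_orthogonal _ _).1 hF _ (Submodule.subset_span ⟨(i, j), rfl⟩)
      have hz : ∀ x : OneMode, (∀ i, ⟪b i, x⟫_ℂ = 0) → x = 0 := by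
        intro x hx
        have := tsum_enorm_sq_inner b x
        simpa [hx] using this.symm
      -- Completeness is used one factor at a time: contracting F with bⱼ on the right gives 0,
      -- hence so does contracting it with an arbitrary f on the left.
      have h1 : ∀ j, (tensorRight (b j)).adjoint F = 0 := fun j =>
        hz _ fun i => by rw [inner_adjoint_tensorRight, h0]
      refine eq_zero_of_forall_inner_prodVec F fun f g => ?_
      have h2 : (tensorLeft f).adjoint F = 0 := hz _ fun j => by
        rw [ContinuousLinearMap.adjoint_inner_right, tensorLeft_apply,
          ← inner_adjoint_tensorRight, h1, inner_zero_right]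
      rw [← tensorLeft_apply, ← ContinuousLinearMap.adjoint_inner_right, h2, inner_zero_right])

theorem prodBasis_apply {ι : Type*} (b : HilbertBasis ι ℂ OneMode) (p : ι × ι) :
    prodBasis b p = prodVec (b p.1) (b p.2) := by
  rw [prodBasis, HilbertBasis.coe_mkOfOrthogonalEqBot]

/-- Parseval in the product basis, grouped by the second index. This is why the partial trace
preserves the trace. -/
theorem tsum_enorm_sq_adjoint_tensorRight {ι : Type*} (b : HilbertBasis ι ℂ OneMode) (F : TwoMode) :
    ∑' j, ‖(tensorRight (b j)).adjoint F‖ₑ ^ 2 = ‖F‖ₑ ^ 2 := by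
  rw [← tsum_enorm_sq_inner (prodBasis b) F, ENNReal.tsum_prod', ENNReal.tsum_comm]
  refine tsum_congr fun j => ?_
  rw [← tsum_enorm_sq_inner b]
  refine tsum_congr fun i => ?_
  rw [inner_adjoint_tensorRight, prodBasis_apply]

/-! ### Convolution with a pure state -/

theorem norm_prodVec (f g : OneMode) : ‖prodVec f g‖ = ‖f‖ * ‖g‖ := by
  rw [← prodEmb_tmul, LinearIsometry.norm_map, TensorProduct.norm_tmul]

theorem ext_prodVec {S T : TwoMode →L[ℂ] TwoMode}
    (h : ∀ f g, S (prodVec f g) = T (prodVec f g)) : S = T := by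
  ext1 F
  refine congrFun (denseRange_prodEmb.equalizer S.continuous T.continuous ?_) F
  funext x
  induction x using TensorProduct.induction_on with
  | zero => simp
  | add x y hx hy =>
    simp only [Function.comp_apply] at hx hy ⊢
    rw [map_add, map_add, map_add, hx, hy]
  | tmul f g => exact h f g

theorem norm_beamSplitter (lam : ℝ) (F : TwoMode) : ‖beamSplitter lam F‖ = ‖F‖ :=
  LinearIsometry.norm_map _ F

/-- The series converges absolutely because its terms have norm ‖vᵢ‖². Its limit needs to be
identified on product vectors only, where it reduces to the series of ρ. -/
theorem IsMixture.hasSum_tensorOp {ρ : OneMode →L[ℂ] OneMode} {ι : Type} {v : ι → OneMode}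
    (h : IsMixture ρ v) {w : OneMode} (hw : ‖w‖ = 1) :
    HasSum (fun i => InnerProductSpace.rankOne ℂ (prodVec (v i) w) (prodVec (v i) w))
      (tensorOp ρ (pureState w)) := by
  have hs : Summable
      (fun i => InnerProductSpace.rankOne ℂ (prodVec (v i) w) (prodVec (v i) w)) := by
    refine summable_rankOne ?_
    simp_rw [← ofReal_norm, norm_prodVec, hw, mul_one, ofReal_norm]
    rw [h.tsum_enorm_sq]
    simp
  obtain ⟨S, hS⟩ := hs
  convert! hS
  refine ext_prodVec fun f g => ?_
  rw [tensorOp_prodVec]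
  have h1 := hS.mapL (ContinuousLinearMap.apply ℂ TwoMode (prodVec f g))
  have h2 := (h.hasSum.mapL (ContinuousLinearMap.apply ℂ OneMode f)).mapL
    (tensorRight (pureState w g))
  refine h2.unique ?_
  convert! h1 using 1
  funext i
  simp only [ContinuousLinearMap.apply_apply, InnerProductSpace.rankOne_apply, inner_prodVec,
    map_smul, tensorRight_apply, pureState]
  rw [← tensorLeft_apply, map_smul, tensorLeft_apply, smul_smul]

/-- The vectors `(I ⊗ ⟨bⱼ|) U (vᵢ ⊗ w)` of a decomposition of `ρ ⊞_lam |w⟩⟨w|`. -/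
def convVec (lam : ℝ) {ι : Type} (v : ι → OneMode) (w : OneMode)
    (p : (exists_hilbertBasis ℂ OneMode).choose × ι) : OneMode :=
  (tensorRight (someBasis p.1)).adjoint (beamSplitter lam (prodVec (v p.2) w))

/-- Conjugation by U replaces vᵢ ⊗ w by U(vᵢ ⊗ w), and the partial trace contracts these with each
bⱼ. The isometry U and Parseval keep the total squared norm equal to 1. -/
theorem IsMixture.conv {ρ : OneMode →L[ℂ] OneMode} {ι : Type} {v : ι → OneMode}
    (h : IsMixture ρ v) {w : OneMode} (hw : ‖w‖ = 1) (lam : ℝ) :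
    IsMixture (conv lam ρ (pureState w)) (convVec lam v w) := by
  have h1 : ∑' p, ‖convVec lam v w p‖ₑ ^ 2 = 1 := by
    rw [ENNReal.tsum_prod', ENNReal.tsum_comm, ← h.tsum_enorm_sq]
    refine tsum_congr fun i => ?_
    simp only [convVec]
    rw [tsum_enorm_sq_adjoint_tensorRight someBasis, ← ofReal_norm, norm_beamSplitter,
      norm_prodVec, hw, mul_one, ofReal_norm]
  refine ⟨h1, ?_⟩
  obtain ⟨S, hS⟩ := summable_rankOne (v := convVec lam v w) (by rw [h1]; simp)
  have h2 : ∀ k, HasSum (fun i => InnerProductSpace.rankOne ℂ (convVec lam v w (k, i))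
      (convVec lam v w (k, i))) ((tensorRight (someBasis k)).adjoint ∘L
      (beamSplitter lam ∘L tensorOp ρ (pureState w) ∘L (beamSplitter lam).adjoint) ∘L
        tensorRight (someBasis k)) := by
    intro k
    have h3 := ((h.hasSum_tensorOp hw).mapL ((ContinuousLinearMap.compL ℂ OneMode TwoMode TwoMode).flip
      ((beamSplitter lam).adjoint ∘L tensorRight (someBasis k)))).mapL
        (ContinuousLinearMap.compL ℂ OneMode TwoMode OneMode
          ((tensorRight (someBasis k)).adjoint ∘L beamSplitter lam))
    convert! h3 using 1
    funext i
    simp only [ContinuousLinearMap.flip_apply, ContinuousLinearMap.compL_apply,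
      InnerProductSpace.rankOne_comp, InnerProductSpace.comp_rankOne,
      ContinuousLinearMap.adjoint_comp, ContinuousLinearMap.adjoint_adjoint, convVec,
      ContinuousLinearMap.comp_apply]
  -- The double family is absolutely summable, so the iterated sum that defines the partial trace
  -- agrees with the sum over pairs.
  have h4 := (hS.prod_fiberwise h2).tsum_eq
  rw [QCLT.conv, partialTrace, h4]
  exact hS

/-! ### Restriction of square integrable functions -/

theorem lintegral_enorm_sq {α : Type*} [MeasurableSpace α] {μ : Measure α} (f : Lp ℂ 2 μ) :
    ∫⁻ x, ‖f x‖ₑ ^ 2 ∂μ = ‖f‖ₑ ^ 2 := by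
  rw [Lp.enorm_def, eLpNorm_eq_lintegral_rpow_enorm_toReal two_ne_zero ENNReal.ofNat_ne_top,
    ← ENNReal.rpow_natCast, ← ENNReal.rpow_mul]
  simp

/-- The product of a square integrable function with the indicator function of a set. -/
def restrictVec {α : Type*} [MeasurableSpace α] {μ : Measure α} {A : Set α} (hA : MeasurableSet A)
    (f : Lp ℂ 2 μ) : Lp ℂ 2 μ := ((Lp.memLp f).indicator hA).toLp

section restrictVec

variable {α : Type*} [MeasurableSpace α] {μ : Measure α} {A : Set α} (hA : MeasurableSet A)

theorem coeFn_restrictVec (f : Lp ℂ 2 μ) : restrictVec hA f =ᵐ[μ] A.indicator f :=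
  ((Lp.memLp f).indicator hA).coeFn_toLp

theorem enorm_restrictVec_sq (f : Lp ℂ 2 μ) :
    ‖restrictVec hA f‖ₑ ^ 2 = ∫⁻ x in A, ‖f x‖ₑ ^ 2 ∂μ := by
  rw [← lintegral_enorm_sq, ← lintegral_indicator hA]
  refine lintegral_congr_ae ?_
  filter_upwards [coeFn_restrictVec hA f] with x hx
  rw [hx]
  by_cases h : x ∈ A <;> simp [h]

theorem inner_restrictVec (f g : Lp ℂ 2 μ) :
    ⟪f, restrictVec hA g⟫_ℂ = ⟪restrictVec hA f, g⟫_ℂ := by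
  rw [L2.inner_def, L2.inner_def]
  refine integral_congr_ae ?_
  filter_upwards [coeFn_restrictVec hA f, coeFn_restrictVec hA g] with x h1 h2
  rw [h1, h2]
  by_cases h : x ∈ A <;> simp [h]

end restrictVec

theorem restrictVec_prodVec {A : Set ℝ} (hA : MeasurableSet A) (f g : OneMode) :
    restrictVec (measurable_fst hA) (prodVec f g) = prodVec (restrictVec hA f) g := by
  refine Lp.ext ?_
  filter_upwards [coeFn_restrictVec (measurable_fst hA) (prodVec f g), coeFn_prodVec f g,
    coeFn_prodVec (restrictVec hA f) g, ae_fst (coeFn_restrictVec hA f)] with p h1 h2 h3 h4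
  rw [h1, h3, h4]
  by_cases h : p.1 ∈ A
  · rw [Set.indicator_of_mem (by exact h), Set.indicator_of_mem h, h2]
  · rw [Set.indicator_of_notMem (by exact h), Set.indicator_of_notMem h, zero_mul]

theorem restrictVec_adjoint_tensorRight {A : Set ℝ} (hA : MeasurableSet A) (g : OneMode)
    (F : TwoMode) : restrictVec hA ((tensorRight g).adjoint F)
      = (tensorRight g).adjoint (restrictVec (measurable_fst hA) F) := by
  refine ext_inner_left ℂ fun f => ?_
  rw [inner_restrictVec, inner_adjoint_tensorRight, inner_adjoint_tensorRight, inner_restrictVec,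
    restrictVec_prodVec]

/-- Multiplication by the indicator of A in the first variable commutes with contraction of the
second, so Parseval applies to the restricted function. Thus the position density after the partial
trace is the first marginal of |F|². -/
theorem tsum_setLIntegral_adjoint_tensorRight {ι : Type*} (b : HilbertBasis ι ℂ OneMode)
    (F : TwoMode) {A : Set ℝ} (hA : MeasurableSet A) :
    ∑' j, ∫⁻ x in A, ‖((tensorRight (b j)).adjoint F : OneMode) x‖ₑ ^ 2
      = ∫⁻ p in Prod.fst ⁻¹' A, ‖F p‖ₑ ^ 2 := by
  simp_rw [← enorm_restrictVec_sq hA, restrictVec_adjoint_tensorRight]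
  rw [tsum_enorm_sq_adjoint_tensorRight, enorm_restrictVec_sq]

/-! ### The law of the position -/

/-- The probability distribution `|w x|² dx` of the position in the pure state `|w⟩⟨w|`. -/
def pureLaw (w : OneMode) : Measure ℝ := volume.withDensity fun x => ‖w x‖ₑ ^ 2

/-- The probability distribution of the position in the state `∑ᵢ |vᵢ⟩⟨vᵢ|`. -/
def positionLaw {ι : Type} (v : ι → OneMode) : Measure ℝ := Measure.sum fun i => pureLaw (v i)

theorem measurable_enorm_sq {α : Type*} [MeasurableSpace α] {μ : Measure α} (f : Lp ℂ 2 μ) :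
    Measurable fun x => ‖f x‖ₑ ^ 2 :=
  (Lp.stronglyMeasurable f).measurable.enorm.pow_const 2

theorem pureLaw_apply (w : OneMode) {A : Set ℝ} (hA : MeasurableSet A) :
    pureLaw w A = ∫⁻ x in A, ‖w x‖ₑ ^ 2 := withDensity_apply _ hA

theorem positionLaw_apply {ι : Type} (v : ι → OneMode) {A : Set ℝ} (hA : MeasurableSet A) :
    positionLaw v A = ∑' i, ∫⁻ x in A, ‖v i x‖ₑ ^ 2 := by
  rw [positionLaw, Measure.sum_apply _ hA]
  exact tsum_congr fun i => pureLaw_apply _ hA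

instance (w : OneMode) : SFinite (pureLaw w) := by unfold pureLaw; infer_instance

theorem isProbabilityMeasure_pureLaw {w : OneMode} (hw : ‖w‖ = 1) :
    IsProbabilityMeasure (pureLaw w) := ⟨by
  rw [pureLaw_apply _ MeasurableSet.univ, Measure.restrict_univ, lintegral_enorm_sq,
    ← ofReal_norm, hw]
  simp⟩

theorem IsMixture.isProbabilityMeasure {ρ : OneMode →L[ℂ] OneMode} {ι : Type} {v : ι → OneMode}
    (h : IsMixture ρ v) : IsProbabilityMeasure (positionLaw v) := ⟨by
  rw [positionLaw_apply _ MeasurableSet.univ, ← h.tsum_enorm_sq]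
  simp_rw [Measure.restrict_univ, lintegral_enorm_sq]⟩

/-- The first row of the inverse rotation. It expresses the output position through the two input
positions. -/
theorem rotation_symm_fst {lam : ℝ} (h0 : 0 ≤ lam) (h1 : lam ≤ 1) (p : ℝ × ℝ) :
    Real.sqrt lam * (rotation (Real.arccos (Real.sqrt lam)) p).1
      + Real.sqrt (1 - lam) * (rotation (Real.arccos (Real.sqrt lam)) p).2 = p.1 := by
  have hc : Real.cos (Real.arccos (Real.sqrt lam)) = Real.sqrt lam :=
    Real.cos_arccos (by linarith [Real.sqrt_nonneg lam]) (Real.sqrt_le_one.2 h1)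
  have hs : Real.sin (Real.arccos (Real.sqrt lam)) = Real.sqrt (1 - lam) := by
    rw [Real.sin_arccos, Real.sq_sqrt h0]
  simp only [rotation, LinearMap.coe_mk, AddHom.coe_mk, hc, hs]
  linear_combination p.1 * Real.sq_sqrt h0 + p.1 * Real.sq_sqrt (sub_nonneg.2 h1)

/-- The rotation preserves Lebesgue measure. In rotated coordinates the density is the product
|v|²|w|² and the event reads √λ x + √(1-λ) y ∈ A, and Tonelli finishes. -/
theorem setLIntegral_beamSplitter_prodVec {lam : ℝ} (h0 : 0 ≤ lam) (h1 : lam ≤ 1) (v w : OneMode)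
    {A : Set ℝ} (hA : MeasurableSet A) :
    ∫⁻ p in Prod.fst ⁻¹' A, ‖(beamSplitter lam (prodVec v w) : TwoMode) p‖ₑ ^ 2
      = ∫⁻ x, pureLaw w ((fun y => Real.sqrt lam * x + Real.sqrt (1 - lam) * y) ⁻¹' A)
          ∂(pureLaw v) := by
  set S : Set (ℝ × ℝ) := (fun p => Real.sqrt lam * p.1 + Real.sqrt (1 - lam) * p.2) ⁻¹' A with hS
  have hSm : MeasurableSet S := by
    refine (by fun_prop : Measurable fun p : ℝ × ℝ =>
      Real.sqrt lam * p.1 + Real.sqrt (1 - lam) * p.2) hA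
  have hmp := measurePreserving_rotation (Real.arccos (Real.sqrt lam))
  have hm : Measurable fun p : ℝ × ℝ => ‖v p.1‖ₑ ^ 2 * ‖w p.2‖ₑ ^ 2 :=
    ((measurable_enorm_sq v).comp measurable_fst).mul ((measurable_enorm_sq w).comp measurable_snd)
  have e1 : ∫⁻ p in Prod.fst ⁻¹' A, ‖(beamSplitter lam (prodVec v w) : TwoMode) p‖ₑ ^ 2
      = ∫⁻ p, S.indicator (fun p => ‖v p.1‖ₑ ^ 2 * ‖w p.2‖ₑ ^ 2)
          (rotation (Real.arccos (Real.sqrt lam)) p) := by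
    rw [← lintegral_indicator (measurable_fst hA)]
    refine lintegral_congr_ae ?_
    filter_upwards [Lp.coeFn_compMeasurePreserving (prodVec v w) hmp,
      hmp.quasiMeasurePreserving.ae (coeFn_prodVec v w)] with p h2 h3
    have h4 : (beamSplitter lam (prodVec v w) : TwoMode) p
        = prodVec v w (rotation (Real.arccos (Real.sqrt lam)) p) := h2
    have h5 : rotation (Real.arccos (Real.sqrt lam)) p ∈ S ↔ p.1 ∈ A := by
      rw [hS, Set.mem_preimage, rotation_symm_fst h0 h1]
    by_cases h : p.1 ∈ A
    · rw [Set.indicator_of_mem (by exact h), Set.indicator_of_mem (h5.2 h), h4, h3, enorm_mul,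
        mul_pow]
    · rw [Set.indicator_of_notMem (by exact h), Set.indicator_of_notMem (mt h5.1 h)]
  rw [e1, hmp.lintegral_comp (hm.indicator hSm), Measure.volume_eq_prod,
    lintegral_prod _ (hm.indicator hSm).aemeasurable]
  have hG : Measurable fun x =>
      pureLaw w ((fun y => Real.sqrt lam * x + Real.sqrt (1 - lam) * y) ⁻¹' A) :=
    measurable_measure_prodMk_left hSm
  have e2 := lintegral_withDensity_eq_lintegral_mul volume (measurable_enorm_sq v) hG
  rw [← pureLaw] at e2
  rw [e2]
  refine lintegral_congr fun x => ?_
  have hSx : MeasurableSet ((fun y => Real.sqrt lam * x + Real.sqrt (1 - lam) * y) ⁻¹' A) :=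
    measurable_prodMk_left hSm
  rw [Pi.mul_apply, pureLaw_apply _ hSx, ← lintegral_const_mul _ (measurable_enorm_sq w),
    ← lintegral_indicator hSx]
  rfl

/-- The bridge to classical probability: at the level of position, quantum convolution is a
normalised sum of independent variables. -/
theorem positionLaw_convVec {lam : ℝ} (h0 : 0 ≤ lam) (h1 : lam ≤ 1) {ι : Type} (v : ι → OneMode)
    (w : OneMode) : positionLaw (convVec lam v w) = ((positionLaw v).prod (pureLaw w)).map
      fun p => Real.sqrt lam * p.1 + Real.sqrt (1 - lam) * p.2 := by
  ext A hA
  have hm : Measurable fun p : ℝ × ℝ => Real.sqrt lam * p.1 + Real.sqrt (1 - lam) * p.2 := by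
    fun_prop
  have e1 : positionLaw (convVec lam v w) A = ∑' i, ∑' j, ∫⁻ x in A,
      ‖((tensorRight (someBasis j)).adjoint (beamSplitter lam (prodVec (v i) w)) : OneMode) x‖ₑ ^ 2 := by
    rw [positionLaw_apply _ hA, ENNReal.tsum_prod', ENNReal.tsum_comm]
    rfl
  rw [Measure.map_apply hm hA, Measure.prod_apply (hm hA), e1]
  unfold positionLaw
  rw [lintegral_sum_measure]
  refine tsum_congr fun i => ?_
  rw [tsum_setLIntegral_adjoint_tensorRight someBasis _ hA,
    setLIntegral_beamSplitter_prodVec h0 h1 (v i) w hA]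
  rfl

theorem charFun_map_add_mul (μ ν : Measure ℝ) [IsProbabilityMeasure μ] [IsProbabilityMeasure ν]
    (r s t : ℝ) : charFun ((μ.prod ν).map fun p => r * p.1 + s * p.2) t
      = charFun μ (r * t) * charFun ν (s * t) := by
  have hr : Measurable fun x : ℝ => r * x := by fun_prop
  have hs : Measurable fun x : ℝ => s * x := by fun_prop
  have := Measure.isProbabilityMeasure_map (μ := μ) hr.aemeasurable
  have := Measure.isProbabilityMeasure_map (μ := ν) hs.aemeasurable
  have h1 : (μ.prod ν).map (fun p => r * p.1 + s * p.2)
      = ((μ.map fun x => r * x).prod (ν.map fun x => s * x)).map fun p => p.1 + p.2 := by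
    rw [Measure.map_prod_map _ _ hr hs, Measure.map_map (by fun_prop) (by fun_prop)]
    rfl
  rw [h1, ProbabilityTheory.charFun_map_add_prod_eq_mul, Pi.mul_apply, charFun_map_mul,
    charFun_map_mul]

theorem exists_isMixture_convPow_charFun {w : OneMode} (hw : ‖w‖ = 1) (n : ℕ) :
    ∃ (ι : Type) (v : ι → OneMode), IsMixture (convPow (pureState w) (n + 1)) v ∧
      ∀ t, charFun (positionLaw v) t
        = charFun (pureLaw w) (t / Real.sqrt ((n : ℝ) + 1)) ^ (n + 1) := by
  induction n with
  | zero =>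
    refine ⟨_, _, isMixture_pureState hw, fun t => ?_⟩
    have : positionLaw (fun _ : Unit => w) = pureLaw w := by
      ext A hA
      rw [positionLaw_apply _ hA, pureLaw_apply _ hA, tsum_fintype]
      simp
    simp [this]
  | succ n ih =>
    obtain ⟨ι, v, hv, hc⟩ := ih
    refine ⟨_, _, hv.conv hw _, fun t => ?_⟩
    have hn : (0 : ℝ) < (n : ℝ) + 1 := by positivity
    have hn2 : (0 : ℝ) < (n : ℝ) + 2 := by positivity
    -- With this transmissivity √λ/√(n+1) = √(1-λ) = 1/√(n+2), so all n + 2 summands get equal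
    -- weight.
    have e : 1 - 1 / ((n : ℝ) + 2) = (n + 1) / (n + 2) := by field_simp; ring
    have := isProbabilityMeasure_pureLaw hw
    have := hv.isProbabilityMeasure
    rw [positionLaw_convVec (by rw [e]; positivity) (by
      have : 0 ≤ 1 / ((n : ℝ) + 2) := by positivity
      linarith), charFun_map_add_mul, hc, e, pow_succ _ (n + 1)]
    have e2 : 1 - ((n : ℝ) + 1) / (n + 2) = 1 / (n + 2) := by field_simp; ring
    have e3 : ((n + 1 : ℕ) : ℝ) + 1 = n + 2 := by push_cast; ring
    have hs : Real.sqrt ((n : ℝ) + 1) ≠ 0 := by positivity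
    rw [e2, e3, Real.sqrt_div hn.le, Real.sqrt_div zero_le_one, Real.sqrt_one]
    have e4 : Real.sqrt ((n : ℝ) + 1) / Real.sqrt (n + 2) * t / Real.sqrt (n + 1)
        = t / Real.sqrt (n + 2) := by field_simp
    rw [e4, one_div_mul_eq_div]

/-! ### Sums of independent variables of infinite variance -/

theorem one_sub_re_charFun (μ : Measure ℝ) [IsProbabilityMeasure μ] (t : ℝ) :
    ENNReal.ofReal (1 - (charFun μ t).re) = ∫⁻ x, ENNReal.ofReal (1 - Real.cos (t * x)) ∂μ := by
  have hi : Integrable (fun x : ℝ => Complex.exp (t * x * Complex.I)) μ := by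
    refine (integrable_const (1 : ℝ)).mono' (by fun_prop) (Eventually.of_forall fun x => ?_)
    rw [← Complex.ofReal_mul, Complex.norm_exp_ofReal_mul_I]
  have hre : (charFun μ t).re = ∫ x, Real.cos (t * x) ∂μ := by
    rw [charFun_apply_real, ← RCLike.re_eq_complex_re, ← integral_re hi]
    refine integral_congr_ae (Eventually.of_forall fun x => ?_)
    simp only [RCLike.re_eq_complex_re]
    rw [← Complex.ofReal_mul, Complex.exp_ofReal_mul_I_re]
  have hc : Integrable (fun x : ℝ => Real.cos (t * x)) μ := by
    refine (integrable_const (1 : ℝ)).mono' (by fun_prop) (Eventually.of_forall fun x => ?_)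
    exact Real.abs_cos_le_one _
  have h1 : Integrable (fun x : ℝ => 1 - Real.cos (t * x)) μ := (integrable_const 1).sub hc
  rw [← ofReal_integral_eq_lintegral_ofReal h1
    (Eventually.of_forall fun x => by simpa using Real.cos_le_one (t * x)),
    integral_sub (integrable_const 1) hc, hre]
  simp

/-- Fatou's lemma: the integrands (n+1)(1 - cos(t x/√(n+1))) are nonnegative and eventually at least
a constant times x², whose integral is infinite. -/
theorem tendsto_mul_one_sub_re_charFun {μ : Measure ℝ} [IsProbabilityMeasure μ]
    (hμ : ∫⁻ x, ENNReal.ofReal (x ^ 2) ∂μ = ∞) {t : ℝ} (ht : t ≠ 0) :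
    Tendsto (fun n : ℕ => ((n : ℝ) + 1) * (1 - (charFun μ (t / Real.sqrt ((n : ℝ) + 1))).re))
      atTop atTop := by
  rw [← ENNReal.tendsto_ofReal_nhds_top]
  have e : ∀ n : ℕ, ENNReal.ofReal
      (((n : ℝ) + 1) * (1 - (charFun μ (t / Real.sqrt ((n : ℝ) + 1))).re))
      = ∫⁻ x, ENNReal.ofReal (((n : ℝ) + 1) *
        (1 - Real.cos (t / Real.sqrt ((n : ℝ) + 1) * x))) ∂μ := by
    intro n
    have hn : (0 : ℝ) ≤ (n : ℝ) + 1 := by positivity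
    rw [ENNReal.ofReal_mul hn, one_sub_re_charFun, ← lintegral_const_mul _ (by fun_prop)]
    simp_rw [ENNReal.ofReal_mul hn]
  simp_rw [e]
  have hF := lintegral_liminf_le (μ := μ) (u := atTop)
    (f := fun (n : ℕ) (x : ℝ) => ENNReal.ofReal (((n : ℝ) + 1) *
        (1 - Real.cos (t / Real.sqrt ((n : ℝ) + 1) * x)))) (fun n => by fun_prop)
  have hlow : ∀ x : ℝ, ENNReal.ofReal (2 / Real.pi ^ 2 * t ^ 2) * ENNReal.ofReal (x ^ 2)
      ≤ liminf (fun n : ℕ => ENNReal.ofReal (((n : ℝ) + 1) *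
        (1 - Real.cos (t / Real.sqrt ((n : ℝ) + 1) * x)))) atTop := by
    intro x
    refine le_liminf_of_le (by isBoundedDefault) ?_
    obtain ⟨N, hN⟩ := exists_nat_ge ((t * x) ^ 2)
    filter_upwards [eventually_ge_atTop N] with n hn
    have hn1 : (0 : ℝ) < (n : ℝ) + 1 := by positivity
    have hNn : (N : ℝ) ≤ n := by exact_mod_cast hn
    have hsq : (t / Real.sqrt ((n : ℝ) + 1) * x) ^ 2 = (t * x) ^ 2 / (n + 1) := by
      rw [mul_pow, div_pow, Real.sq_sqrt hn1.le]; ring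
    -- For n ≥ (t x)² the argument lies in [-1, 1], inside the range where 1 - cos u ≥ 2u²/π².
    have habs : |t / Real.sqrt ((n : ℝ) + 1) * x| ≤ Real.pi := by
      refine (?_ : _ ≤ (1 : ℝ)).trans (by linarith [Real.pi_gt_three])
      rw [← sq_le_one_iff_abs_le_one, hsq, div_le_one hn1]
      linarith
    have := Real.cos_le_one_sub_mul_cos_sq habs
    rw [← ENNReal.ofReal_mul (by positivity)]
    refine ENNReal.ofReal_le_ofReal ?_
    rw [hsq] at this
    calc 2 / Real.pi ^ 2 * t ^ 2 * x ^ 2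
        = (n + 1) * (2 / Real.pi ^ 2 * ((t * x) ^ 2 / (n + 1))) := by field_simp
      _ ≤ _ := by gcongr; linarith
  have hinf : ∫⁻ x, ENNReal.ofReal (2 / Real.pi ^ 2 * t ^ 2) * ENNReal.ofReal (x ^ 2) ∂μ = ∞ := by
    rw [lintegral_const_mul _ (by fun_prop), hμ, ENNReal.mul_top]
    have : 0 < 2 / Real.pi ^ 2 * t ^ 2 := by positivity
    simpa using this
  have htop := (lintegral_mono hlow).trans hF
  rw [hinf] at htop
  exact tendsto_of_le_liminf_of_limsup_le htop le_top

/-- By symmetry φ is real, and by continuity φ(t/√(n+1)) is eventually positive. Then φ ≤ exp(-(1 -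
φ)) may be raised to the power n + 1, and the exponent tends to -∞. -/
theorem tendsto_charFun_pow {μ : Measure ℝ} [IsProbabilityMeasure μ]
    (hμ : ∫⁻ x, ENNReal.ofReal (x ^ 2) ∂μ = ∞) (hs : μ.map Neg.neg = μ) {t : ℝ} (ht : t ≠ 0) :
    Tendsto (fun n : ℕ => charFun μ (t / Real.sqrt ((n : ℝ) + 1)) ^ (n + 1)) atTop (𝓝 0) := by
  have hreal : ∀ s, charFun μ s = ((charFun μ s).re : ℂ) := by
    intro s
    have h1 := charFun_map_mul (μ := μ) (-1) s
    have h2 : (fun x : ℝ => -1 * x) = Neg.neg := by funext x; simp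
    rw [h2, hs, neg_one_mul, charFun_neg] at h1
    exact (Complex.conj_eq_iff_re.1 h1.symm).symm
  have h0 : Tendsto (fun n : ℕ => t / Real.sqrt ((n : ℝ) + 1)) atTop (𝓝 0) := by
    refine Tendsto.div_atTop tendsto_const_nhds ?_
    exact Real.tendsto_sqrt_atTop.comp
      (tendsto_atTop_add_const_right _ _ tendsto_natCast_atTop_atTop)
  have h1 : Tendsto (fun n : ℕ => (charFun μ (t / Real.sqrt ((n : ℝ) + 1))).re) atTop (𝓝 1) := by
    have hc : Continuous fun s => (charFun μ s).re :=
      Complex.continuous_re.comp continuous_charFun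
    have := (hc.tendsto 0).comp h0
    simpa [Function.comp_def] using this
  have hexp : Tendsto (fun n : ℕ => Real.exp (-(((n : ℝ) + 1) *
      (1 - (charFun μ (t / Real.sqrt ((n : ℝ) + 1))).re)))) atTop (𝓝 0) :=
    Real.tendsto_exp_neg_atTop_nhds_zero.comp (tendsto_mul_one_sub_re_charFun hμ ht)
  refine squeeze_zero_norm' ?_ hexp
  filter_upwards [h1.eventually (lt_mem_nhds zero_lt_one)] with n hn
  rw [norm_pow, congrArg norm (hreal _), Complex.norm_real, Real.norm_of_nonneg hn.le]
  calc (charFun μ (t / Real.sqrt ((n : ℝ) + 1))).re ^ (n + 1)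
      ≤ Real.exp (-(1 - (charFun μ (t / Real.sqrt ((n : ℝ) + 1))).re)) ^ (n + 1) := by
        refine pow_le_pow_left₀ hn.le ?_ _
        have := Real.add_one_le_exp (-(1 - (charFun μ (t / Real.sqrt ((n : ℝ) + 1))).re))
        linarith
    _ = _ := by
        rw [← Real.exp_nat_mul]
        congr 1
        push_cast
        ring

/-! ### Vanishing characteristic functions and escape of mass -/

/-- Fubini, together with the fact that the characteristic function of the standard Gaussian is
exp(-x²/2). -/
theorem integral_charFun_gaussianReal (μ : Measure ℝ) [IsProbabilityMeasure μ] :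
    ∫ t, charFun μ t ∂(ProbabilityTheory.gaussianReal 0 1)
      = ((∫ x, Real.exp (-x ^ 2 / 2) ∂μ : ℝ) : ℂ) := by
  have hi : Integrable (fun p : ℝ × ℝ => Complex.exp (p.1 * p.2 * Complex.I))
      ((ProbabilityTheory.gaussianReal 0 1).prod μ) := by
    refine (integrable_const (1 : ℝ)).mono' (by fun_prop) (Eventually.of_forall fun x => ?_)
    rw [← Complex.ofReal_mul, Complex.norm_exp_ofReal_mul_I]
  simp_rw [charFun_apply_real]
  rw [integral_integral_swap hi, ← integral_complex_ofReal]
  refine integral_congr_ae (Eventually.of_forall fun x => ?_)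
  have := ProbabilityTheory.charFun_gaussianReal (μ := 0) (v := 1) x
  rw [charFun_apply_real] at this
  simp_rw [mul_comm (x : ℂ)] at this
  simp only [this]
  push_cast
  congr 1
  simp
  ring

/-- Averaging over a Gaussian t turns pointwise vanishing into ∫ exp(-x²/2) dμₙ → 0 by dominated
convergence; the exceptional point t = 0 is a null set. On [-R, R] the indicator is at most
exp(R²/2) exp(-x²/2). -/
theorem tendsto_measure_Icc_of_tendsto_charFun {μ : ℕ → Measure ℝ}
    (hp : ∀ n, IsProbabilityMeasure (μ n))
    (h : ∀ t ≠ 0, Tendsto (fun n => charFun (μ n) t) atTop (𝓝 0)) (R : ℝ) :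
    Tendsto (fun n => μ n (Set.Icc (-R) R)) atTop (𝓝 0) := by
  have h1 : Tendsto (fun n => ∫ t, charFun (μ n) t ∂(ProbabilityTheory.gaussianReal 0 1))
      atTop (𝓝 0) := by
    have := tendsto_integral_of_dominated_convergence (μ := ProbabilityTheory.gaussianReal 0 1)
      (F := fun n t => charFun (μ n) t) (f := fun _ => 0) (fun _ => (1 : ℝ))
      (fun n => stronglyMeasurable_charFun.aestronglyMeasurable) (integrable_const 1)
      (fun n => Eventually.of_forall fun t => norm_charFun_le_one t) ?_
    · simpa using this
    · have := ProbabilityTheory.nullSingletonClass_gaussianReal (μ := 0) (v := 1) one_ne_zero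
      filter_upwards [compl_mem_ae_iff.2 (measure_singleton
        (μ := ProbabilityTheory.gaussianReal 0 1) (0 : ℝ))] with t ht
      exact h t ht
  simp_rw [integral_charFun_gaussianReal] at h1
  have h2 : Tendsto (fun n => ∫ x, Real.exp (-x ^ 2 / 2) ∂(μ n)) atTop (𝓝 0) := by
    rw [← Complex.ofReal_zero] at h1
    exact tendsto_ofReal_iff'.1 h1
  have h3 : Tendsto (fun n => ENNReal.ofReal (Real.exp (R ^ 2 / 2) *
      ∫ x, Real.exp (-x ^ 2 / 2) ∂(μ n))) atTop (𝓝 0) := by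
    have := ENNReal.tendsto_ofReal (h2.const_mul (Real.exp (R ^ 2 / 2)))
    simpa using this
  refine tendsto_of_tendsto_of_tendsto_of_le_of_le tendsto_const_nhds h3
    (fun n => zero_le) fun n => ?_
  have hint : Integrable (fun x : ℝ => Real.exp (R ^ 2 / 2) * Real.exp (-x ^ 2 / 2)) (μ n) := by
    refine (integrable_const (Real.exp (R ^ 2 / 2))).mono' (by fun_prop)
      (Eventually.of_forall fun x => ?_)
    rw [Real.norm_of_nonneg (by positivity)]
    refine mul_le_of_le_one_right (by positivity) (Real.exp_le_one_iff.2 ?_)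
    have := sq_nonneg x
    linarith
  rw [← integral_const_mul, ofReal_integral_eq_lintegral_ofReal hint
    (Eventually.of_forall fun x => by positivity), ← lintegral_indicator_one measurableSet_Icc]
  refine lintegral_mono fun x => ?_
  by_cases hx : x ∈ Set.Icc (-R) R
  · rw [Set.indicator_of_mem hx, Pi.one_apply, ENNReal.one_le_ofReal, ← Real.exp_add,
      Real.one_le_exp_iff]
    have := sq_le_sq' hx.1 hx.2
    linarith
  · rw [Set.indicator_of_notMem hx]
    exact zero_le

/-! ### Weak limits -/

/-- Cauchy–Schwarz after moving the indicator from ψ to each vᵢ. Only position information on ρ is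
needed to bound its matrix elements on functions supported in A. -/
theorem IsMixture.enorm_inner_restrictVec_le {ρ : OneMode →L[ℂ] OneMode} {ι : Type}
    {v : ι → OneMode} (h : IsMixture ρ v) {A : Set ℝ} (hA : MeasurableSet A) (ψ : OneMode) :
    ‖⟪restrictVec hA ψ, ρ (restrictVec hA ψ)⟫_ℂ‖ₑ ≤ positionLaw v A * ‖ψ‖ₑ ^ 2 := by
  rw [h.enorm_inner, positionLaw_apply v hA, ← ENNReal.tsum_mul_right]
  refine ENNReal.tsum_le_tsum fun i => ?_
  rw [inner_restrictVec, ← enorm_restrictVec_sq hA, ← mul_pow]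
  gcongr
  simp only [← ofReal_norm]
  rw [← ENNReal.ofReal_mul (norm_nonneg _)]
  exact ENNReal.ofReal_le_ofReal (norm_inner_le_norm _ _)

theorem tendsto_restrictVec_Icc (ψ : OneMode) :
    Tendsto (fun n : ℕ => restrictVec (measurableSet_Icc (a := -(n : ℝ)) (b := n)) ψ)
      atTop (𝓝 ψ) := by
  have hsub : ∀ n : ℕ, ‖restrictVec (measurableSet_Icc (a := -(n : ℝ)) (b := n)) ψ - ψ‖ₑ ^ 2
      = pureLaw ψ (Set.Icc (-(n : ℝ)) n)ᶜ := by
    intro n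
    rw [pureLaw_apply _ measurableSet_Icc.compl, ← lintegral_indicator measurableSet_Icc.compl,
      ← lintegral_enorm_sq]
    refine lintegral_congr_ae ?_
    filter_upwards [Lp.coeFn_sub (restrictVec (measurableSet_Icc (a := -(n : ℝ)) (b := n)) ψ) ψ,
      coeFn_restrictVec (measurableSet_Icc (a := -(n : ℝ)) (b := n)) ψ] with x h1 h2
    rw [h1, Pi.sub_apply, h2]
    by_cases hx : x ∈ Set.Icc (-(n : ℝ)) n
    · rw [Set.indicator_of_mem hx, Set.indicator_of_notMem (by simpa using hx)]
      simp
    · rw [Set.indicator_of_notMem hx, Set.indicator_of_mem (by exact hx)]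
      simp
  have hfin : pureLaw ψ (Set.Icc (-((0 : ℕ) : ℝ)) (0 : ℕ))ᶜ ≠ ∞ := by
    rw [← hsub 0]
    simp
  have h1 := tendsto_measure_iInter_atTop (μ := pureLaw ψ)
    (s := fun n : ℕ => (Set.Icc (-(n : ℝ)) n)ᶜ)
    (fun n => measurableSet_Icc.compl.nullMeasurableSet)
    (fun m n hmn => Set.compl_subset_compl.2 (Set.Icc_subset_Icc
      (by simpa using hmn) (by simpa using hmn))) ⟨0, hfin⟩
  have h2 : (⋂ n : ℕ, (Set.Icc (-(n : ℝ)) n)ᶜ) = ∅ := by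
    rw [← Set.compl_iUnion, Set.compl_empty_iff]
    refine Set.eq_univ_of_forall fun x => ?_
    obtain ⟨n, hn⟩ := exists_nat_ge |x|
    exact Set.mem_iUnion.2 ⟨n, abs_le.1 hn⟩
  rw [h2, measure_empty] at h1
  have h3 : Tendsto (fun n : ℕ =>
      ‖restrictVec (measurableSet_Icc (a := -(n : ℝ)) (b := n)) ψ - ψ‖ₑ ^ 2) atTop (𝓝 0) := by
    simp_rw [hsub]
    exact h1
  rw [tendsto_iff_norm_sub_tendsto_zero]
  have h4 := (ENNReal.tendsto_toReal ENNReal.zero_ne_top).comp h3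
  simp only [Function.comp_def, ENNReal.toReal_pow, toReal_enorm, ENNReal.toReal_zero] at h4
  have h5 := h4.sqrt
  simpa using h5

theorem not_convergesWeakly_convPow {w : OneMode} (hw : ‖w‖ = 1)
    (hinf : ∫⁻ x, ENNReal.ofReal (x ^ 2) ∂(pureLaw w) = ∞) (hs : (pureLaw w).map Neg.neg = pureLaw w)
    {σ : OneMode →L[ℂ] OneMode} (hσ : IsState σ) :
    ¬ ConvergesWeakly (convPow (pureState w)) σ := by
  intro hconv
  choose ι v hv hc using exists_isMixture_convPow_charFun hw
  have := isProbabilityMeasure_pureLaw hw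
  have h0 : ∀ R, Tendsto (fun n => positionLaw (v n) (Set.Icc (-R) R)) atTop (𝓝 0) := by
    refine tendsto_measure_Icc_of_tendsto_charFun (fun n => (hv n).isProbabilityMeasure) ?_
    intro t ht
    simp_rw [hc]
    exact tendsto_charFun_pow hinf hs ht
  have h1 : ∀ (R : ℝ) (ψ : OneMode), ⟪restrictVec (measurableSet_Icc (a := -R) (b := R)) ψ,
      σ (restrictVec (measurableSet_Icc (a := -R) (b := R)) ψ)⟫_ℂ = 0 := by
    intro R ψ
    set x := restrictVec (measurableSet_Icc (a := -R) (b := R)) ψ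
    -- The decompositions describe `convPow` at n + 1, so the sequence is shifted past its unused
    -- value at 0.
    have h2 := (hconv x x).comp (tendsto_add_atTop_nat 1)
    refine tendsto_nhds_unique h2 ?_
    rw [tendsto_zero_iff_enorm_tendsto_zero]
    have h3 : Tendsto (fun n => positionLaw (v n) (Set.Icc (-R) R) * ‖ψ‖ₑ ^ 2) atTop (𝓝 0) := by
      have := ENNReal.Tendsto.mul_const (b := ‖ψ‖ₑ ^ 2) (h0 R) (Or.inr (by simp))
      simpa using this
    exact tendsto_of_tendsto_of_tendsto_of_le_of_le tendsto_const_nhds h3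
      (fun n => zero_le) fun n => (hv n).enorm_inner_restrictVec_le measurableSet_Icc ψ
  have h2 : ∀ ψ : OneMode, ⟪ψ, σ ψ⟫_ℂ = 0 := by
    intro ψ
    have h3 := tendsto_restrictVec_Icc ψ
    have h4 := h3.inner (𝕜 := ℂ) ((σ.continuous.tendsto ψ).comp h3)
    refine tendsto_nhds_unique h4 ?_
    simp only [Function.comp_def, h1]
    exact tendsto_const_nhds
  have h3 := hσ.2 _ someBasis
  simp only [h2] at h3
  exact zero_ne_one (hasSum_zero.unique h3)

/-! ### Expected values on pure states -/

/-- Some eᵢ is not orthogonal to ψ, and its eigenvalue equation makes ψ a phase times eᵢ with pᵢ =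
1. The other eⱼ are then orthogonal to ψ and have eigenvalue 0. Phase invariance of q does the rest.
-/
theorem tsum_eigen_rankOne {ι : Type*} {e : HilbertBasis ι ℂ OneMode} {p : ι → ℝ}
    {q : OneMode → ℝ≥0∞} {ψ : OneMode} (hψ : ‖ψ‖ = 1)
    (hq : ∀ (c : ℂ) (φ : OneMode), ‖c‖ = 1 → q (c • φ) = q φ)
    (hd : ∀ i, ⟪ψ, e i⟫_ℂ • ψ = (p i : ℂ) • e i) :
    ∑' i, ENNReal.ofReal (p i) * q (e i) = q ψ := by
  have hne : ∀ i, e i ≠ 0 := e.orthonormal.ne_zero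
  have hψ0 : ψ ≠ 0 := by
    rintro rfl
    simp at hψ
  obtain ⟨i, hi⟩ : ∃ i, ⟪e i, ψ⟫_ℂ ≠ 0 := by
    by_contra! h
    have := tsum_enorm_sq_inner e ψ
    simp only [h, enorm_zero, ne_eq, OfNat.ofNat_ne_zero, not_false_eq_true, zero_pow, tsum_zero]
      at this
    exact hψ0 (enorm_eq_zero.1 (pow_eq_zero_iff two_ne_zero |>.1 this.symm))
  have hi' : ⟪ψ, e i⟫_ℂ ≠ 0 := fun h => hi (inner_eq_zero_symm.1 h)
  set c := ⟪ψ, e i⟫_ℂ with hc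
  have hψe : ψ = ((p i : ℂ) / c) • e i := by
    rw [div_eq_inv_mul, mul_smul, ← hd, smul_smul, inv_mul_cancel₀ hi', one_smul]
  have hunit : ‖(p i : ℂ) / c‖ = 1 := by
    have := congrArg norm hψe
    rw [norm_smul, e.orthonormal.1 i, hψ, mul_one] at this
    exact this.symm
  have hp : p i = 1 := by
    have h1 : c = starRingEnd ℂ ((p i : ℂ) / c) := by
      conv_lhs => rw [hc, hψe, inner_smul_left, inner_self_eq_norm_sq_to_K, e.orthonormal.1 i]
      simp
    have h2 : ‖c‖ = 1 := by rw [h1, RCLike.norm_conj, hunit]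
    have h3 : (p i : ℂ) = starRingEnd ℂ c * c := by
      conv_rhs => rw [congrArg (starRingEnd ℂ) h1, Complex.conj_conj]
      field_simp
    rw [RCLike.conj_mul, h2] at h3
    simpa using h3
  have hz : ∀ j, j ≠ i → p j = 0 := by
    intro j hj
    have h1 : ⟪ψ, e j⟫_ℂ = 0 := by
      rw [hψe, inner_smul_left, e.orthonormal.2 hj.symm, mul_zero]
    have h2 := hd j
    rw [h1, zero_smul] at h2
    exact_mod_cast (smul_eq_zero.1 h2.symm).resolve_right (hne j)
  rw [tsum_eq_single i fun j hj => by rw [hz j hj]; simp, hp]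
  conv_rhs => rw [hψe, hq _ _ hunit]
  simp

/-- Needed because `expected` is an infimum over decompositions, which would be ∞ if there were
none. -/
theorem nonempty_spectralDecomposition_pureState {ψ : OneMode} (hψ : ‖ψ‖ = 1) :
    Nonempty (SpectralDecomposition (pureState ψ)) := by
  classical
  have ho : Orthonormal ℂ ((↑) : ({ψ} : Set OneMode) → OneMode) := by
    constructor
    · rintro ⟨x, rfl⟩
      exact hψ
    · rintro ⟨x, rfl⟩ ⟨y, rfl⟩ h
      exact absurd rfl h
  obtain ⟨s, b, hs, hb⟩ := ho.exists_hilbertBasis_extension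
  refine ⟨⟨s, b, fun i => if i = ⟨ψ, hs rfl⟩ then 1 else 0, fun i => ?_⟩⟩
  have hbψ : b ⟨ψ, hs rfl⟩ = ψ := by rw [hb]
  have h1 : pureState ψ (b i) = ⟪b ⟨ψ, hs rfl⟩, b i⟫_ℂ • ψ := by
    rw [hbψ]
    rfl
  rw [h1, orthonormal_iff_ite.1 b.orthonormal]
  by_cases h : i = ⟨ψ, hs rfl⟩
  · subst h
    simp [hbψ]
  · simp [h, Ne.symm h]

theorem expected_pureState {q : OneMode → ℝ≥0∞} {ψ : OneMode} (hψ : ‖ψ‖ = 1)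
    (hq : ∀ (c : ℂ) (φ : OneMode), ‖c‖ = 1 → q (c • φ) = q φ) :
    expected q (pureState ψ) = q ψ := by
  have := nonempty_spectralDecomposition_pureState hψ
  have h : ∀ d : SpectralDecomposition (pureState ψ),
      ∑' i, ENNReal.ofReal (d.p i) * q (d.e i) = q ψ := fun d => tsum_eigen_rankOne hψ hq d.eigen
  simp only [expected, h, ciInf_const]

theorem positionPart_smul (s : ℝ) {c : ℂ} (hc : ‖c‖ = 1) (φ : OneMode) :
    positionPart s (c • φ) = positionPart s φ := by
  refine lintegral_congr_ae ?_
  filter_upwards [Lp.coeFn_smul c φ] with x hx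
  rw [hx, Pi.smul_apply, enorm_smul, ← ofReal_norm, hc]
  simp

theorem momentumPart_smul (s : ℝ) {c : ℂ} (hc : ‖c‖ = 1) (φ : OneMode) :
    momentumPart s (c • φ) = momentumPart s φ := by
  refine lintegral_congr_ae ?_
  rw [FourierTransform.fourier_smul]
  filter_upwards [Lp.coeFn_smul c (𝓕 φ : OneMode)] with x hx
  rw [hx, Pi.smul_apply, enorm_smul, ← ofReal_norm, hc]
  simp

theorem powForm_smul (r : ℝ) {c : ℂ} (hc : ‖c‖ = 1) (φ : OneMode) :
    powForm r (c • φ) = powForm r φ := by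
  refine tsum_congr fun n => ?_
  have h : fockCoeff n (c • φ) = c * fockCoeff n φ := by
    rw [fockCoeff, fockCoeff, ← integral_const_mul]
    refine integral_congr_ae ?_
    filter_upwards [Lp.coeFn_smul c φ] with x hx
    rw [hx, Pi.smul_apply, smul_eq_mul]
    ring
  rw [h, enorm_mul, ← ofReal_norm c, hc]
  simp

/-! ### The Fourier transform of integrable and square integrable functions -/

theorem integral_fourier_smul {f g : ℝ → ℂ} (hf : Integrable f) (hg : Integrable g) :
    ∫ ξ, 𝓕 f ξ • g ξ = ∫ x, f x • 𝓕 g x := by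
  have := VectorFourier.integral_fourierIntegral_smul_eq_flip (μ := (volume : Measure ℝ))
    (ν := (volume : Measure ℝ)) (L := innerₗ ℝ) Real.continuous_fourierChar
    continuous_inner hf hg
  rw [flip_innerₗ] at this
  exact this

/-- Both transforms have the same integrals against smooth compactly supported functions, by the
multiplication formula ∫ f̂ g = ∫ f ĝ. The integral formula for the L² transform gives access to
parity and to the rule for derivatives. -/
theorem coeFn_fourier_toLp {f : ℝ → ℂ} (h1 : Integrable f) (h2 : MemLp f 2) :
    (𝓕 (h2.toLp : OneMode) : OneMode) =ᵐ[volume] 𝓕 f := by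
  have hc : Continuous (𝓕 f) :=
    VectorFourier.fourierIntegral_continuous Real.continuous_fourierChar continuous_inner h1
  refine ae_eq_of_integral_contDiff_smul_eq ((Lp.memLp _).locallyIntegrable one_le_two)
    hc.locallyIntegrable fun g hg hgc => ?_
  have hg1 : HasCompactSupport (Complex.ofRealCLM ∘ g) := hgc.comp_left rfl
  have hg2 : ContDiff ℝ (⊤ : ℕ∞) (Complex.ofRealCLM ∘ g) := by fun_prop
  set φ := hg1.toSchwartzMap hg2 with hφ
  have hφa : ∀ x, φ x = (g x : ℂ) := fun x => rfl
  have e1 := congrArg (fun T => T φ) (Lp.fourier_toTemperedDistribution_eq (h2.toLp : OneMode))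
  simp only [TemperedDistribution.fourier_apply, Lp.toTemperedDistribution_apply] at e1
  have e2 := integral_fourier_smul (f := φ) (g := f) φ.integrable h1
  have e3 : ∫ x, (𝓕 φ) x • (h2.toLp : OneMode) x = ∫ x, 𝓕 (φ : ℝ → ℂ) x • f x := by
    refine integral_congr_ae ?_
    filter_upwards [h2.coeFn_toLp] with x hx
    rw [hx]
    rfl
  exact e1.symm.trans (e3.trans e2)

theorem fourier_neg_of_even {f : ℝ → ℂ} (hf : ∀ x, f (-x) = f x) (ξ : ℝ) : 𝓕 f (-ξ) = 𝓕 f ξ := by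
  rw [← Real.fourierInv_eq_fourier_neg, Real.fourierInv_eq_fourier_comp_neg]
  simp_rw [hf]

/-- From |y| ≤ 1 + y² with y = 2πξ, and y f̂ being the transform of f′ up to a phase, the integral
is at most ‖f‖² + ‖f′‖² by Plancherel. -/
theorem momentumPart_lt_top {f : ℝ → ℂ} (h1 : Integrable f) (h2 : MemLp f 2)
    (hd : Differentiable ℝ f) (h1' : Integrable (deriv f)) (h2' : MemLp (deriv f) 2) {s : ℝ}
    (hs : |s| = 1) : momentumPart s h2.toLp < ∞ := by
  have hbound : momentumPart s h2.toLp ≤ ∫⁻ ξ : ℝ, (‖(𝓕 (h2.toLp : OneMode) : OneMode) ξ‖ₑ ^ 2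
      + ‖(𝓕 (h2'.toLp : OneMode) : OneMode) ξ‖ₑ ^ 2) := by
    refine lintegral_mono_ae ?_
    filter_upwards [coeFn_fourier_toLp h1 h2, coeFn_fourier_toLp h1' h2'] with ξ e1 e2
    rw [e1, e2, Real.fourier_deriv h1 hd h1']
    simp only [smul_eq_mul]
    rw [enorm_mul, mul_pow, ← one_add_mul]
    gcongr
    have e3 : ‖(2 * Real.pi * Complex.I * ξ : ℂ)‖ₑ = ENNReal.ofReal |2 * Real.pi * ξ| := by
      rw [← ofReal_norm]
      congr 1
      simp [abs_mul]
    rw [e3, ← ENNReal.ofReal_pow (abs_nonneg _), ← ENNReal.ofReal_one,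
      ← ENNReal.ofReal_add zero_le_one (by positivity)]
    refine ENNReal.ofReal_le_ofReal ((le_abs_self _).trans ?_)
    rw [abs_mul, hs, one_mul]
    nlinarith [sq_nonneg (|2 * Real.pi * ξ| - 1)]
  refine hbound.trans_lt ?_
  rw [lintegral_add_left (measurable_enorm_sq _), lintegral_enorm_sq, lintegral_enorm_sq]
  simp [ENNReal.add_lt_top]

theorem lintegral_ofReal_neg_mul {g : ℝ → ℝ≥0∞} (hg : ∀ᵐ x, g (-x) = g x) (c : ℝ) :
    ∫⁻ x, ENNReal.ofReal (-1 * (c * x)) * g x = ∫⁻ x, ENNReal.ofReal (1 * (c * x)) * g x := by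
  rw [← (Measure.measurePreserving_neg (volume : Measure ℝ)).lintegral_comp_emb
    (MeasurableEquiv.neg ℝ).measurableEmbedding]
  refine lintegral_congr_ae ?_
  filter_upwards [hg] with x hx
  rw [hx]
  congr 2
  ring

theorem momentumPart_neg_one_of_even {f : ℝ → ℂ} (h1 : Integrable f) (h2 : MemLp f 2)
    (hf : ∀ x, f (-x) = f x) : momentumPart (-1) h2.toLp = momentumPart 1 h2.toLp := by
  refine lintegral_ofReal_neg_mul
    (g := fun ξ => ‖(𝓕 (h2.toLp : OneMode) : OneMode) ξ‖ₑ ^ 2) ?_ _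
  have e := coeFn_fourier_toLp h1 h2
  filter_upwards [e, (Measure.measurePreserving_neg (volume : Measure ℝ)).quasiMeasurePreserving.ae e]
    with ξ e1 e2
  rw [e1, e2, fourier_neg_of_even hf]

theorem positionPart_neg_one_of_even {f : ℝ → ℂ} (h2 : MemLp f 2)
    (hf : ∀ x, f (-x) = f x) : positionPart (-1) h2.toLp = positionPart 1 h2.toLp := by
  have e := h2.coeFn_toLp
  have h := lintegral_ofReal_neg_mul (g := fun x => ‖(h2.toLp : OneMode) x‖ₑ ^ 2) (by
    filter_upwards [e,
      (Measure.measurePreserving_neg (volume : Measure ℝ)).quasiMeasurePreserving.ae e] with x e1 e2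
    rw [e1, e2, hf]) 1
  simp only [one_mul (_ : ℝ)] at h
  simpa only [positionPart, one_mul (_ : ℝ)] using h

theorem positionPart_lt_top {f : ℝ → ℂ} (h2 : MemLp f 2)
    (h1 : Integrable fun x : ℝ => |x| * ‖f x‖ ^ 2) {s : ℝ} (hs : |s| = 1) :
    positionPart s h2.toLp < ∞ := by
  refine lt_of_le_of_lt (lintegral_mono_ae ?_) h1.lintegral_lt_top
  filter_upwards [h2.coeFn_toLp] with x hx
  rw [hx, ← ofReal_norm, ← ENNReal.ofReal_pow (norm_nonneg _), ENNReal.ofReal_mul (abs_nonneg _)]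
  gcongr
  calc s * x ≤ |s * x| := le_abs_self _
    _ = |x| := by rw [abs_mul, hs, one_mul]

theorem isCentred_pureState_of_even {f : ℝ → ℂ} (h1 : Integrable f) (h2 : MemLp f 2)
    (hn : ‖(h2.toLp : OneMode)‖ = 1) (hf : ∀ x, f (-x) = f x)
    (hx : Integrable fun x : ℝ => |x| * ‖f x‖ ^ 2)
    (hd : Differentiable ℝ f) (h1' : Integrable (deriv f)) (h2' : MemLp (deriv f) 2) :
    IsCentred (pureState h2.toLp) := by
  have ep : ∀ s, expected (positionPart s) (pureState h2.toLp) = positionPart s h2.toLp :=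
    fun s => expected_pureState hn fun c φ hc => positionPart_smul s hc φ
  have em : ∀ s, expected (momentumPart s) (pureState h2.toLp) = momentumPart s h2.toLp :=
    fun s => expected_pureState hn fun c φ hc => momentumPart_smul s hc φ
  have habs : ∀ s ∈ ({1, -1} : Set ℝ), |s| = 1 := by
    rintro s (rfl | rfl) <;> simp
  refine ⟨fun s hs => ?_, fun s hs => ?_, ?_, ?_⟩
  · rw [ep]
    exact positionPart_lt_top h2 hx (habs s hs)
  · rw [em]
    exact momentumPart_lt_top h1 h2 hd h1' h2' (habs s hs)
  · rw [ep, ep, positionPart_neg_one_of_even h2 hf, sub_self]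
  · rw [em, em, momentumPart_neg_one_of_even h1 h2 hf, sub_self]

/-! ### Powers of `1 + x²` -/

theorem integrable_bracket {s : ℝ} (hs : 1 / 2 < s) :
    Integrable fun x : ℝ => (1 + x ^ 2) ^ (-s) := by
  have := integrable_rpow_neg_one_add_norm_sq (E := ℝ) (μ := volume) (r := 2 * s)
    (by simp; linarith)
  refine this.congr (Eventually.of_forall fun x => ?_)
  simp only [Real.norm_eq_abs, sq_abs]
  congr 1
  ring

theorem hasDerivAt_bracket (s x : ℝ) :
    HasDerivAt (fun x : ℝ => (1 + x ^ 2) ^ (-s)) (-(2 * s * x) * (1 + x ^ 2) ^ (-s - 1)) x := by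
  have h1 : HasDerivAt (fun x : ℝ => 1 + x ^ 2) (2 * x) x := by
    simpa using (hasDerivAt_pow 2 x).const_add 1
  refine (h1.rpow_const (p := -s) (Or.inl (by positivity))).congr_deriv ?_
  ring

theorem continuous_bracket (s : ℝ) : Continuous fun x : ℝ => (1 + x ^ 2) ^ (-s) :=
  continuous_iff_continuousAt.2 fun x => (hasDerivAt_bracket s x).continuousAt

theorem bracket_sq (s x : ℝ) : ((1 + x ^ 2) ^ (-s)) ^ 2 = (1 + x ^ 2) ^ (-(2 * s)) := by
  rw [← Real.rpow_natCast, ← Real.rpow_mul (by positivity)]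
  congr 1
  push_cast
  ring

/-- Since |x| ≤ (1 + x²)^{1/2}, a factor x costs half a power of the bracket. -/
theorem abs_mul_bracket_le (s x : ℝ) : |x| * (1 + x ^ 2) ^ (-s - 1 / 2) ≤ (1 + x ^ 2) ^ (-s) := by
  have h : (1 + x ^ 2) ^ (-s) = (1 + x ^ 2) ^ (1 / 2 : ℝ) * (1 + x ^ 2) ^ (-s - 1 / 2) := by
    rw [← Real.rpow_add (by positivity)]
    congr 1; ring
  rw [h]
  gcongr
  rw [← Real.sqrt_eq_rpow]
  refine Real.abs_le_sqrt ?_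
  linarith

theorem bracket_le_bracket {s t : ℝ} (h : s ≤ t) (x : ℝ) :
    (1 + x ^ 2) ^ (-t) ≤ (1 + x ^ 2) ^ (-s) :=
  Real.rpow_le_rpow_of_exponent_le (by nlinarith [sq_nonneg x]) (by linarith)

theorem memLp_two_of_sq_le {g h : ℝ → ℝ} (hg : AEStronglyMeasurable g) (hh : Integrable h)
    (hle : ∀ x, g x ^ 2 ≤ h x) : MemLp g 2 := by
  rw [memLp_two_iff_integrable_sq hg]
  refine hh.mono' (hg.pow 2) (Eventually.of_forall fun x => ?_)
  rw [Real.norm_of_nonneg (sq_nonneg _)]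
  exact hle x

/-! ### The wave function -/

/-- The primitive x (1 + x²)^{-1/2} runs from -1 to 1. The value 2 is what normalises f. -/
theorem integral_bracket_three_halves : ∫ x : ℝ, (1 + x ^ 2) ^ (-(3 / 2) : ℝ) = 2 := by
  have hd : ∀ x : ℝ, HasDerivAt (fun x : ℝ => x * (1 + x ^ 2) ^ (-(1 / 2) : ℝ))
      ((1 + x ^ 2) ^ (-(3 / 2) : ℝ)) x := by
    intro x
    refine ((hasDerivAt_id x).mul (hasDerivAt_bracket (1 / 2) x)).congr_deriv ?_
    have h : (1 + x ^ 2) ^ (-(1 / 2) : ℝ) = (1 + x ^ 2) * (1 + x ^ 2) ^ (-(3 / 2) : ℝ) := by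
      rw [← Real.rpow_one_add' (by positivity) (by norm_num)]
      norm_num
    rw [h, show (-(1 / 2) - 1 : ℝ) = -(3 / 2) by norm_num]
    simp only [id]
    ring
  have htop : Tendsto (fun x : ℝ => x * (1 + x ^ 2) ^ (-(1 / 2) : ℝ)) atTop (𝓝 1) := by
    have h1 : Tendsto (fun x : ℝ => Real.sqrt (1 - (1 + x ^ 2)⁻¹)) atTop (𝓝 (Real.sqrt (1 - 0))) := by
      refine (Tendsto.const_sub _ (tendsto_inv_atTop_zero.comp ?_)).sqrt
      exact tendsto_atTop_add_const_left _ _ (tendsto_pow_atTop two_ne_zero)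
    rw [sub_zero, Real.sqrt_one] at h1
    refine h1.congr' ?_
    filter_upwards [eventually_ge_atTop 0] with x hx
    have h2 : 1 - (1 + x ^ 2)⁻¹ = x ^ 2 / (1 + x ^ 2) := by field_simp; ring
    rw [h2, Real.sqrt_div (sq_nonneg x), Real.sqrt_sq hx, Real.rpow_neg (by positivity),
      ← Real.sqrt_eq_rpow, div_eq_mul_inv]
  have hbot : Tendsto (fun x : ℝ => x * (1 + x ^ 2) ^ (-(1 / 2) : ℝ)) atBot (𝓝 (-1)) := by
    refine (htop.comp tendsto_neg_atBot_atTop).neg.congr fun x => ?_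
    simp
  rw [integral_of_hasDerivAt_of_tendsto hd (integrable_bracket (by norm_num)) hbot htop]
  norm_num

/-- The wave function as a real function. -/
def waveReal (x : ℝ) : ℝ := 1 / Real.sqrt 2 * (1 + x ^ 2) ^ (-(3 / 4) : ℝ)

theorem waveFun_eq (x : ℝ) : waveFun x = (waveReal x : ℂ) := by
  rw [waveFun, waveReal, Real.rpow_neg (by positivity), one_div ((1 + x ^ 2) ^ (3 / 4 : ℝ))]

theorem waveReal_sq (x : ℝ) : waveReal x ^ 2 = 1 / 2 * (1 + x ^ 2) ^ (-(3 / 2) : ℝ) := by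
  rw [waveReal, mul_pow, bracket_sq, div_pow, Real.sq_sqrt zero_le_two]
  norm_num

theorem waveReal_neg (x : ℝ) : waveReal (-x) = waveReal x := by simp [waveReal]

theorem norm_waveFun_sq (x : ℝ) : ‖waveFun x‖ ^ 2 = 1 / 2 * (1 + x ^ 2) ^ (-(3 / 2) : ℝ) := by
  rw [waveFun_eq, Complex.norm_real, Real.norm_eq_abs, sq_abs, waveReal_sq]

theorem enorm_waveVec_sq :
    ∀ᵐ x, ‖waveVec x‖ₑ ^ 2 = ENNReal.ofReal (1 / 2 * (1 + x ^ 2) ^ (-(3 / 2) : ℝ)) := by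
  filter_upwards [memLp_waveFun.coeFn_toLp] with x hx
  rw [waveVec, hx, ← ofReal_norm, ← ENNReal.ofReal_pow (norm_nonneg _), norm_waveFun_sq]

theorem norm_waveVec : ‖waveVec‖ = 1 := by
  have h : ‖waveVec‖ₑ ^ 2 = 1 := by
    rw [← lintegral_enorm_sq, lintegral_congr_ae enorm_waveVec_sq,
      ← ofReal_integral_eq_lintegral_ofReal ((integrable_bracket (by norm_num)).const_mul _)
        (Eventually.of_forall fun x => by positivity), integral_const_mul,
      integral_bracket_three_halves]
    norm_num
  have h2 := congrArg ENNReal.toReal h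
  rw [ENNReal.toReal_pow, toReal_enorm, ENNReal.toReal_one] at h2
  exact (pow_eq_one_iff_of_nonneg (norm_nonneg _) two_ne_zero).1 h2

theorem hasDerivAt_waveReal (x : ℝ) :
    HasDerivAt waveReal (-(3 / 2) / Real.sqrt 2 * (x * (1 + x ^ 2) ^ (-(7 / 4) : ℝ))) x := by
  refine ((hasDerivAt_bracket (3 / 4) x).const_mul (1 / Real.sqrt 2)).congr_deriv ?_
  rw [show (-(3 / 4) - 1 : ℝ) = -(7 / 4) by norm_num]
  ring

theorem isCentred_waveVec : IsCentred (pureState waveVec) := by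
  have hd : ∀ x, HasDerivAt waveFun
      ((-(3 / 2) / Real.sqrt 2 * (x * (1 + x ^ 2) ^ (-(7 / 4) : ℝ)) : ℝ) : ℂ) x := by
    intro x
    have : waveFun = fun x => (waveReal x : ℂ) := funext waveFun_eq
    rw [this]
    exact (hasDerivAt_waveReal x).ofReal_comp
  have hd' : deriv waveFun = fun x =>
      ((-(3 / 2) / Real.sqrt 2 * (x * (1 + x ^ 2) ^ (-(7 / 4) : ℝ)) : ℝ) : ℂ) :=
    funext fun x => (hd x).deriv
  have hle : ∀ x : ℝ, |x * (1 + x ^ 2) ^ (-(7 / 4) : ℝ)| ≤ (1 + x ^ 2) ^ (-(5 / 4) : ℝ) := by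
    intro x
    have := abs_mul_bracket_le (5 / 4) x
    rw [abs_mul, abs_of_nonneg (a := (1 + x ^ 2) ^ (-(7 / 4) : ℝ)) (by positivity)]
    convert! this using 3
    norm_num
  have hc : Continuous fun x : ℝ => x * (1 + x ^ 2) ^ (-(7 / 4) : ℝ) :=
    continuous_id.mul (continuous_bracket _)
  refine isCentred_pureState_of_even ?_ memLp_waveFun norm_waveVec ?_ ?_
    (fun x => (hd x).differentiableAt) ?_ ?_
  · simp_rw [funext waveFun_eq]
    exact ((integrable_bracket (by norm_num)).const_mul _).ofReal
  · intro x
    rw [waveFun_eq, waveFun_eq, waveReal_neg]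
  · simp_rw [norm_waveFun_sq]
    refine ((integrable_bracket (s := 1) (by norm_num)).const_mul (1 / 2)).mono'
      ((continuous_abs.mul (continuous_const.mul (continuous_bracket _))).aestronglyMeasurable)
      (Eventually.of_forall fun x => ?_)
    have := abs_mul_bracket_le 1 x
    rw [show (-1 - 1 / 2 : ℝ) = -(3 / 2) by norm_num] at this
    rw [Real.norm_of_nonneg (by positivity)]
    linarith
  · rw [hd']
    refine Integrable.ofReal (Integrable.const_mul ?_ _)
    exact (integrable_bracket (s := 5 / 4) (by norm_num)).mono' hc.aestronglyMeasurable
      (Eventually.of_forall hle)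
  · rw [hd']
    refine MemLp.ofReal (MemLp.const_mul ?_ _)
    refine memLp_two_of_sq_le hc.aestronglyMeasurable
      (integrable_bracket (s := 2 * (5 / 4)) (by norm_num)) fun x => ?_
    rw [← bracket_sq]
    exact sq_le_sq.2 ((hle x).trans (le_abs_self _))

theorem pureLaw_waveVec : pureLaw waveVec
    = volume.withDensity fun x => ENNReal.ofReal (1 / 2 * (1 + x ^ 2) ^ (-(3 / 2) : ℝ)) :=
  withDensity_congr_ae enorm_waveVec_sq

theorem measurable_waveDensity :
    Measurable fun x : ℝ => ENNReal.ofReal (1 / 2 * (1 + x ^ 2) ^ (-(3 / 2) : ℝ)) := by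
  fun_prop

theorem map_neg_pureLaw_waveVec : (pureLaw waveVec).map Neg.neg = pureLaw waveVec := by
  ext A hA
  rw [Measure.map_apply measurable_neg hA, pureLaw_waveVec, withDensity_apply _ hA,
    withDensity_apply _ (measurable_neg hA), ← lintegral_indicator hA,
    ← lintegral_indicator (measurable_neg hA),
    ← (Measure.measurePreserving_neg (volume : Measure ℝ)).lintegral_comp_emb
    (MeasurableEquiv.neg ℝ).measurableEmbedding (A.indicator _)]
  refine lintegral_congr fun x => ?_
  by_cases h : -x ∈ A
  · rw [Set.indicator_of_mem (by exact h), Set.indicator_of_mem h, neg_sq]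
  · rw [Set.indicator_of_notMem (by exact h), Set.indicator_of_notMem h]

theorem lintegral_sq_pureLaw_waveVec : ∫⁻ x, ENNReal.ofReal (x ^ 2) ∂(pureLaw waveVec) = ∞ := by
  rw [pureLaw_waveVec, lintegral_withDensity_eq_lintegral_mul _ measurable_waveDensity
    (by fun_prop)]
  by_contra hfin
  refine not_integrableOn_Ioi_inv (a := (1 : ℝ)) ?_
  have hi : Integrable fun x : ℝ => 1 / 2 * (1 + x ^ 2) ^ (-(3 / 2) : ℝ) * x ^ 2 := by
    refine ⟨((continuous_const.mul (continuous_bracket _)).mul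
      (continuous_pow 2)).aestronglyMeasurable, ?_⟩
    rw [hasFiniteIntegral_iff_ofReal (Eventually.of_forall fun x => by positivity)]
    refine lt_of_le_of_lt (le_of_eq (lintegral_congr fun x => ?_)) (lt_top_iff_ne_top.2 hfin)
    rw [Pi.mul_apply, ENNReal.ofReal_mul (by positivity)]
  -- For x > 1 one has 1 + x² ≤ 2x², so the integrand is at least x⁻¹ / (2 · 2^{3/2}), and x⁻¹ is
  -- not integrable at infinity.
  refine (hi.const_mul (2 * 2 ^ (3 / 2 : ℝ))).integrableOn.mono'
    measurable_inv.aestronglyMeasurable ?_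
  filter_upwards [ae_restrict_mem measurableSet_Ioi] with x hx
  have hx0 : (0 : ℝ) < x := zero_lt_one.trans hx
  rw [Real.norm_of_nonneg (by positivity)]
  have h1 : (2 * x ^ 2) ^ (-(3 / 2) : ℝ) ≤ (1 + x ^ 2) ^ (-(3 / 2) : ℝ) := by
    refine Real.rpow_le_rpow_of_nonpos (by positivity) ?_ (by norm_num)
    have : (1 : ℝ) < x := hx
    nlinarith
  have h2 : (2 * x ^ 2) ^ (-(3 / 2) : ℝ) = (2 ^ (3 / 2 : ℝ))⁻¹ * (x ^ 3)⁻¹ := by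
    rw [Real.rpow_neg (by positivity), Real.mul_rpow zero_le_two (by positivity),
      ← Real.rpow_natCast x 2, ← Real.rpow_mul hx0.le, mul_inv]
    norm_num
  calc x⁻¹ = 2 * 2 ^ (3 / 2 : ℝ) * (1 / 2 * ((2 ^ (3 / 2 : ℝ))⁻¹ * (x ^ 3)⁻¹) * x ^ 2) := by
        field_simp
    _ ≤ _ := by rw [← h2]; gcongr

/-! ### Integration by parts -/

/-- Functions on which creation and annihilation operators are defined in `L²`. -/
structure InLadderDomain (g : ℝ → ℝ) : Prop where
  differentiable : Differentiable ℝ g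
  memLp : MemLp g 2
  memLp_mul : MemLp (fun x => x * g x) 2
  memLp_deriv : MemLp (deriv g) 2

theorem InLadderDomain.memLp_creation {g : ℝ → ℝ} (hg : InLadderDomain g) :
    MemLp (creation g) 2 := by
  have := (hg.memLp_mul.sub hg.memLp_deriv).const_mul (1 / Real.sqrt 2)
  refine this.ae_eq (Eventually.of_forall fun x => ?_)
  simp only [creation, Pi.sub_apply]
  ring

/-- Integration by parts. No boundary terms appear because g h, g h′ and g′ h are all integrable, as
products of square integrable functions. -/
theorem integral_mul_annihilation {g h : ℝ → ℝ} (hg : InLadderDomain g) (hh : InLadderDomain h) :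
    ∫ x, g x * annihilation h x = ∫ x, creation g x * h x := by
  have h1 : Integrable (fun x => g x * deriv h x) := hg.memLp.integrable_mul hh.memLp_deriv
  have h2 : Integrable (fun x => deriv g x * h x) := hg.memLp_deriv.integrable_mul hh.memLp
  have h3 : Integrable (fun x => g x * h x) := hg.memLp.integrable_mul hh.memLp
  have h4 : Integrable (fun x => g x * (x * h x)) := hg.memLp.integrable_mul hh.memLp_mul
  have h5 := integral_mul_deriv_eq_deriv_mul_of_integrable (u := g) (v := h)
    (fun x _ => (hg.differentiable x).hasDerivAt) (fun x _ => (hh.differentiable x).hasDerivAt)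
    h1 h2 h3
  have e1 : ∀ x, g x * annihilation h x
      = (1 / Real.sqrt 2) * (g x * (x * h x) + g x * deriv h x) := by
    intro x; simp only [annihilation]; ring
  have e2 : ∀ x, creation g x * h x
      = (1 / Real.sqrt 2) * (g x * (x * h x) - deriv g x * h x) := by
    intro x; simp only [creation]; ring
  simp_rw [e1, e2]
  rw [integral_const_mul, integral_const_mul, integral_add h4 h1, integral_sub h4 h2, h5]
  ring

/-! ### Polynomials times Gaussians -/

/-- Functions of the form `P(x) exp (-x²/2)`. -/
def IsHermiteType (g : ℝ → ℝ) : Prop :=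
  ∃ P : Polynomial ℝ, g = fun x => P.eval x * Real.exp (-x ^ 2 / 2)

theorem integrable_eval_mul_exp_neg_sq (P : Polynomial ℝ) :
    Integrable fun x : ℝ => P.eval x * Real.exp (-x ^ 2) := by
  induction P using Polynomial.induction_on' with
  | add p q hp hq =>
    refine (hp.add hq).congr (Eventually.of_forall fun x => ?_)
    simp [add_mul]
  | monomial n c =>
    have h := (integrable_rpow_mul_exp_neg_mul_sq (b := 1) one_pos (s := n)
      (by have := n.cast_nonneg (α := ℝ); linarith)).const_mul c
    refine h.congr (Eventually.of_forall fun x => ?_)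
    simp [mul_assoc]

namespace IsHermiteType

theorem memLp {g : ℝ → ℝ} (hg : IsHermiteType g) : MemLp g 2 := by
  obtain ⟨P, rfl⟩ := hg
  have hc : Continuous fun x : ℝ => P.eval x * Real.exp (-x ^ 2 / 2) := by fun_prop
  rw [memLp_two_iff_integrable_sq hc.aestronglyMeasurable]
  refine (integrable_eval_mul_exp_neg_sq (P * P)).congr (Eventually.of_forall fun x => ?_)
  simp only [Polynomial.eval_mul]
  rw [mul_pow, ← Real.exp_nat_mul, ← pow_two]
  congr 2
  push_cast
  ring

theorem hasDerivAt (P : Polynomial ℝ) (x : ℝ) :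
    HasDerivAt (fun x => P.eval x * Real.exp (-x ^ 2 / 2))
      ((P.derivative - Polynomial.X * P).eval x * Real.exp (-x ^ 2 / 2)) x := by
  have h1 : HasDerivAt (fun y : ℝ => -y ^ 2 / 2) (-x) x := by
    refine (((hasDerivAt_pow 2 x).neg).div_const 2).congr_deriv ?_
    simp
    ring
  refine ((P.hasDerivAt x).mul h1.exp).congr_deriv ?_
  simp
  ring

theorem deriv {g : ℝ → ℝ} (hg : IsHermiteType g) : IsHermiteType (deriv g) := by
  obtain ⟨P, rfl⟩ := hg
  exact ⟨_, funext fun x => (hasDerivAt P x).deriv⟩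

theorem differentiable {g : ℝ → ℝ} (hg : IsHermiteType g) : Differentiable ℝ g := by
  obtain ⟨P, rfl⟩ := hg
  exact fun x => (hasDerivAt P x).differentiableAt

theorem id_mul {g : ℝ → ℝ} (hg : IsHermiteType g) : IsHermiteType fun x => x * g x := by
  obtain ⟨P, rfl⟩ := hg
  exact ⟨Polynomial.X * P, by funext x; simp [mul_assoc]⟩

theorem const_mul {g : ℝ → ℝ} (hg : IsHermiteType g) (c : ℝ) :
    IsHermiteType fun x => c * g x := by
  obtain ⟨P, rfl⟩ := hg
  exact ⟨Polynomial.C c * P, by funext x; simp [mul_assoc]⟩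

theorem sub {g h : ℝ → ℝ} (hg : IsHermiteType g) (hh : IsHermiteType h) :
    IsHermiteType fun x => g x - h x := by
  obtain ⟨P, rfl⟩ := hg
  obtain ⟨Q, rfl⟩ := hh
  exact ⟨P - Q, by funext x; simp [sub_mul]⟩

theorem creation {g : ℝ → ℝ} (hg : IsHermiteType g) : IsHermiteType (creation g) := by
  have := (hg.id_mul.sub hg.deriv).const_mul (1 / Real.sqrt 2)
  convert! this using 1
  funext x
  simp only [QCLT.creation]
  ring

theorem inLadderDomain {g : ℝ → ℝ} (hg : IsHermiteType g) : InLadderDomain g :=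
  ⟨hg.differentiable, hg.memLp, hg.id_mul.memLp, hg.deriv.memLp⟩

end IsHermiteType

/-! ### Fock states -/

theorem isHermiteType_fock (n : ℕ) : IsHermiteType (fock n) := by
  refine IsHermiteType.const_mul ?_ _
  induction n with
  | zero => exact ⟨Polynomial.C (Real.pi ^ (-(1 / 4) : ℝ)), by simp⟩
  | succ n ih =>
    rw [Function.iterate_succ_apply']
    exact ih.creation

theorem creation_fock (n : ℕ) :
    creation (fock n) = fun x => Real.sqrt ((n : ℝ) + 1) * fock (n + 1) x := by
  have hf : ∀ n, fock n = fun x => (Real.sqrt (n.factorial))⁻¹ * creation^[n]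
    (fun y => Real.pi ^ (-(1 / 4) : ℝ) * Real.exp (-y ^ 2 / 2)) x := fun n => rfl
  rw [hf n, creation_const_mul, hf (n + 1), Function.iterate_succ_apply', Nat.factorial_succ]
  funext x
  have h1 : Real.sqrt ((n : ℝ) + 1) ≠ 0 := by positivity
  push_cast
  rw [Real.sqrt_mul (by positivity)]
  field_simp

theorem annihilation_fock_succ (n : ℕ) :
    annihilation (fock (n + 1)) = fun x => Real.sqrt ((n : ℝ) + 1) * fock n x := by
  have h1 : Real.sqrt ((n : ℝ) + 1) ≠ 0 := by positivity
  have h2 := annihilation_creation_fock n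
  rw [creation_fock, annihilation_const_mul] at h2
  funext x
  have h3 := congrFun h2 x
  have h4 := Real.mul_self_sqrt (show 0 ≤ (n : ℝ) + 1 by positivity)
  refine mul_left_cancel₀ h1 ?_
  rw [h3, ← mul_assoc, h4]

/-- Moves a† across and uses a a†|n⟩ = (n+1)|n⟩. The case m = n gives normalisation by induction;
comparison with the roles of m and n exchanged gives orthogonality. -/
theorem integral_creation_fock_mul (m n : ℕ) :
    ∫ x, creation (fock m) x * creation (fock n) x = ((n : ℝ) + 1) * ∫ x, fock m x * fock n x := by
  rw [← integral_mul_annihilation (isHermiteType_fock m).inLadderDomain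
    (isHermiteType_fock n).creation.inLadderDomain, annihilation_creation_fock,
    ← integral_const_mul]
  congr 1
  funext x
  ring

theorem integral_fock_mul_fock_self (n : ℕ) : ∫ x, fock n x * fock n x = 1 := by
  induction n with
  | zero =>
    have h1 : ∀ x, fock 0 x * fock 0 x = Real.pi ^ (-(1 / 2) : ℝ) * Real.exp (-1 * x ^ 2) := by
      intro x
      simp only [fock, Nat.factorial_zero, Nat.cast_one, Real.sqrt_one, inv_one, one_mul,
        Function.iterate_zero, id]
      rw [mul_mul_mul_comm, ← Real.rpow_add Real.pi_pos, ← Real.exp_add]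
      congr 2
      · norm_num
      · ring
    simp_rw [h1]
    rw [integral_const_mul, integral_gaussian, div_one, Real.sqrt_eq_rpow,
      ← Real.rpow_add Real.pi_pos]
    norm_num
  | succ n ih =>
    have h1 := integral_creation_fock_mul n n
    have h2 := Real.mul_self_sqrt (show 0 ≤ (n : ℝ) + 1 by positivity)
    have h3 : (n : ℝ) + 1 ≠ 0 := by positivity
    rw [ih, creation_fock] at h1
    have h4 : ∀ x, Real.sqrt ((n : ℝ) + 1) * fock (n + 1) x * (Real.sqrt ((n : ℝ) + 1) *
        fock (n + 1) x) = ((n : ℝ) + 1) * (fock (n + 1) x * fock (n + 1) x) := by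
      intro x
      rw [mul_mul_mul_comm, h2]
    simp_rw [h4] at h1
    rw [integral_const_mul] at h1
    exact mul_left_cancel₀ h3 h1

theorem integral_fock_mul_fock_of_ne {m n : ℕ} (h : m ≠ n) : ∫ x, fock m x * fock n x = 0 := by
  have h1 := integral_creation_fock_mul m n
  have h2 := integral_creation_fock_mul n m
  simp_rw [mul_comm (creation (fock n) _), mul_comm (fock n _)] at h2
  rw [h1] at h2
  have h3 : ((n : ℝ) - m) * ∫ x, fock m x * fock n x = 0 := by linear_combination h2
  refine (mul_eq_zero.1 h3).resolve_left ?_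
  refine sub_ne_zero.2 ?_
  exact_mod_cast h.symm

/-- A real square integrable function as a vector of `L²(ℝ)`. -/
def realVec {g : ℝ → ℝ} (hg : MemLp g 2) : OneMode := (hg.ofReal (K := ℂ)).toLp

theorem coeFn_realVec {g : ℝ → ℝ} (hg : MemLp g 2) :
    realVec hg =ᵐ[volume] fun x => (g x : ℂ) := (hg.ofReal (K := ℂ)).coeFn_toLp

theorem enorm_realVec_sq {g : ℝ → ℝ} (hg : MemLp g 2) :
    ‖realVec hg‖ₑ ^ 2 = ∫⁻ x, ENNReal.ofReal (g x ^ 2) := by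
  rw [← lintegral_enorm_sq]
  refine lintegral_congr_ae ?_
  filter_upwards [coeFn_realVec hg] with x hx
  rw [hx, ← ofReal_norm, ← ENNReal.ofReal_pow (norm_nonneg _), Complex.norm_real,
    Real.norm_eq_abs, sq_abs]

theorem fockCoeff_realVec (n : ℕ) {g : ℝ → ℝ} (hg : MemLp g 2) :
    fockCoeff n (realVec hg) = ((∫ x, fock n x * g x : ℝ) : ℂ) := by
  rw [← integral_complex_ofReal]
  refine integral_congr_ae ?_
  filter_upwards [coeFn_realVec hg] with x hx
  rw [hx]
  push_cast
  rfl

theorem fockCoeff_eq_inner (n : ℕ) (ψ : OneMode) :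
    fockCoeff n ψ = ⟪realVec (isHermiteType_fock n).memLp, ψ⟫_ℂ := by
  rw [L2.inner_def]
  refine integral_congr_ae ?_
  filter_upwards [coeFn_realVec (isHermiteType_fock n).memLp] with x hx
  rw [hx]
  simp [mul_comm]

theorem fockCoeff_add (n : ℕ) (φ ψ : OneMode) :
    fockCoeff n (φ + ψ) = fockCoeff n φ + fockCoeff n ψ := by
  simp only [fockCoeff_eq_inner, inner_add_right]

theorem orthonormal_fock :
    Orthonormal ℂ fun n : ℕ => realVec (isHermiteType_fock n).memLp := by
  rw [orthonormal_iff_ite]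
  intro m n
  rw [← fockCoeff_eq_inner, fockCoeff_realVec]
  split_ifs with h
  · rw [h, integral_fock_mul_fock_self, Complex.ofReal_one]
  · rw [integral_fock_mul_fock_of_ne h, Complex.ofReal_zero]

/-- Bessel's inequality for the Fock states. -/
theorem tsum_enorm_fockCoeff_sq_le (ψ : OneMode) :
    ∑' n, ‖fockCoeff n ψ‖ₑ ^ 2 ≤ ‖ψ‖ₑ ^ 2 := by
  simp_rw [fockCoeff_eq_inner]
  have h1 := orthonormal_fock.inner_products_summable ψ
  have h2 := ENNReal.ofReal_tsum_of_nonneg (fun n => by positivity) h1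
  have h3 := ENNReal.ofReal_le_ofReal (orthonormal_fock.tsum_inner_products_le ψ)
  rw [h2] at h3
  simpa [ENNReal.ofReal_pow] using h3

theorem sqrt_mul_integral_fock_mul (n : ℕ) {g : ℝ → ℝ} (hg : InLadderDomain g) :
    Real.sqrt ((n : ℝ) + 1) * ∫ x, fock n x * g x = ∫ x, fock (n + 1) x * creation g x := by
  have h1 := integral_mul_annihilation hg (isHermiteType_fock (n + 1)).inLadderDomain
  rw [annihilation_fock_succ] at h1
  simp_rw [mul_comm (fock (n + 1) _), ← h1]
  rw [← integral_const_mul]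
  congr 1
  funext x
  ring

/-- Since √(n+1)⟨n|g⟩ = ⟨n+1|a†g⟩, this is Bessel's inequality for a†g. Only orthonormality of the
Fock states enters, not completeness. -/
theorem tsum_mul_enorm_fockCoeff_sq_le {g : ℝ → ℝ} (hg : InLadderDomain g) :
    ∑' n : ℕ, ENNReal.ofReal ((n : ℝ) + 1) * ‖fockCoeff n (realVec hg.memLp)‖ₑ ^ 2
      ≤ ∫⁻ x, ENNReal.ofReal (creation g x ^ 2) := by
  rw [← enorm_realVec_sq hg.memLp_creation]
  refine le_trans ?_ (tsum_enorm_fockCoeff_sq_le _)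
  refine le_trans (ENNReal.tsum_le_tsum fun n => le_of_eq ?_)
    (ENNReal.tsum_comp_le_tsum_of_injective (add_left_injective 1) _)
  have h2 : (0 : ℝ) ≤ (n : ℝ) + 1 := by positivity
  rw [fockCoeff_realVec, fockCoeff_realVec, ← sqrt_mul_integral_fock_mul n hg]
  push_cast
  rw [enorm_mul, mul_pow, ← ofReal_norm ((Real.sqrt ((n : ℝ) + 1) : ℝ) : ℂ), Complex.norm_real, Real.norm_of_nonneg (Real.sqrt_nonneg _),
    ← ENNReal.ofReal_pow (Real.sqrt_nonneg _), Real.sq_sqrt h2]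

/-! ### Real interpolation -/

/-- Bounds on the `K`-functional `∑ₙ min (1, ε (n + 1)) aₙ` imply bounds on moments. -/
theorem tsum_rpow_mul_lt_top {a : ℕ → ℝ≥0∞} {C : ℝ≥0∞} (hC : C ≠ ∞) {r s : ℝ} (hr : 0 ≤ r)
    (hrs : r < s) (h : ∀ ε : ℝ, 0 < ε → ε ≤ 1 →
      ∑' n : ℕ, min 1 (ENNReal.ofReal (ε * ((n : ℝ) + 1))) * a n ≤ ENNReal.ofReal (ε ^ s) * C) :
    ∑' n : ℕ, ENNReal.ofReal (((n : ℝ) + 1) ^ r) * a n < ∞ := by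
  -- One term suffices: for 2^k ≤ n + 1 < 2^{k+1} the minimum equals 1 and the weight exceeds
  -- (n+1)^r.
  have hdyadic : ∀ n : ℕ, ENNReal.ofReal (((n : ℝ) + 1) ^ r) ≤
      ∑' k : ℕ, ENNReal.ofReal (((2 : ℝ) ^ (k + 1)) ^ r) *
        min 1 (ENNReal.ofReal ((2⁻¹ : ℝ) ^ k * ((n : ℝ) + 1))) := by
    intro n
    refine le_trans ?_ (ENNReal.le_tsum (Nat.log 2 (n + 1)))
    have h1 : 2 ^ Nat.log 2 (n + 1) ≤ n + 1 := Nat.pow_log_le_self 2 (by omega)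
    have h2 : n + 1 < 2 ^ (Nat.log 2 (n + 1) + 1) := Nat.lt_pow_succ_log_self (by omega) _
    have h1' : (2 : ℝ) ^ Nat.log 2 (n + 1) ≤ (n : ℝ) + 1 := by exact_mod_cast h1
    have h2' : (n : ℝ) + 1 ≤ (2 : ℝ) ^ (Nat.log 2 (n + 1) + 1) := by exact_mod_cast h2.le
    rw [min_eq_left, mul_one]
    · exact ENNReal.ofReal_le_ofReal (Real.rpow_le_rpow (by positivity) h2' hr)
    · rw [ENNReal.one_le_ofReal, inv_pow, inv_mul_eq_div, one_le_div (by positivity)]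
      exact h1'
  -- At scale ε = 2^{-k} the weight times the bound is geometric with ratio 2^{r-s}, which is less
  -- than 1 because r < s.
  have hterm : ∀ k : ℕ, ((2 : ℝ) ^ (k + 1)) ^ r * ((2⁻¹ : ℝ) ^ k) ^ s
      = 2 ^ r * ((2 : ℝ) ^ (r - s)) ^ k := by
    intro k
    rw [pow_succ, Real.mul_rpow (by positivity) zero_le_two, ← Real.rpow_natCast 2 k,
      ← Real.rpow_natCast 2⁻¹ k, ← Real.rpow_natCast (2 ^ (r - s)) k, Real.inv_rpow zero_le_two,
      ← Real.rpow_neg zero_le_two, ← Real.rpow_mul zero_le_two, ← Real.rpow_mul zero_le_two,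
      ← Real.rpow_mul zero_le_two, mul_right_comm, mul_comm _ ((2 : ℝ) ^ r),
      ← Real.rpow_add zero_lt_two]
    congr 2
    ring
  have hlt : (2 : ℝ) ^ (r - s) < 1 :=
    Real.rpow_lt_one_of_one_lt_of_neg one_lt_two (by linarith)
  have hgeo : Summable fun k : ℕ => 2 ^ r * ((2 : ℝ) ^ (r - s)) ^ k :=
    (summable_geometric_of_lt_one (by positivity) hlt).mul_left _
  calc ∑' n : ℕ, ENNReal.ofReal (((n : ℝ) + 1) ^ r) * a n
      ≤ ∑' n : ℕ, ∑' k : ℕ, ENNReal.ofReal (((2 : ℝ) ^ (k + 1)) ^ r) *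
        (min 1 (ENNReal.ofReal ((2⁻¹ : ℝ) ^ k * ((n : ℝ) + 1))) * a n) := by
        refine ENNReal.tsum_le_tsum fun n => ?_
        simp_rw [← mul_assoc]
        rw [ENNReal.tsum_mul_right]
        gcongr
        exact hdyadic n
    _ = ∑' k : ℕ, ENNReal.ofReal (((2 : ℝ) ^ (k + 1)) ^ r) *
        ∑' n : ℕ, min 1 (ENNReal.ofReal ((2⁻¹ : ℝ) ^ k * ((n : ℝ) + 1))) * a n := by
        rw [ENNReal.tsum_comm]
        simp_rw [ENNReal.tsum_mul_left]
    _ ≤ ∑' k : ℕ, ENNReal.ofReal (2 ^ r * ((2 : ℝ) ^ (r - s)) ^ k) * C := by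
        refine ENNReal.tsum_le_tsum fun k => ?_
        rw [← hterm, ENNReal.ofReal_mul (by positivity), mul_assoc]
        gcongr
        exact h _ (by positivity) (pow_le_one₀ (by norm_num) (by norm_num))
    _ < ∞ := by
        rw [ENNReal.tsum_mul_right, ← ENNReal.ofReal_tsum_of_nonneg (fun k => by positivity) hgeo]
        exact ENNReal.mul_lt_top ENNReal.ofReal_lt_top hC.lt_top

/-! ### Smooth truncation of the wave function -/

/-- The wave function damped at distances `ε^{-1/2}`. -/
def waveDamped (ε x : ℝ) : ℝ := waveReal x * (1 + ε * x ^ 2)⁻¹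

/-- The part of the wave function removed by damping. -/
def waveTail (ε x : ℝ) : ℝ := waveReal x * (ε * x ^ 2 * (1 + ε * x ^ 2)⁻¹)

theorem waveDamped_add_waveTail {ε : ℝ} (hε : 0 < ε) (x : ℝ) :
    waveDamped ε x + waveTail ε x = waveReal x := by
  have : 1 + ε * x ^ 2 ≠ 0 := by positivity
  rw [waveDamped, waveTail]
  field_simp

theorem hasDerivAt_waveDamped {ε : ℝ} (hε : 0 < ε) (x : ℝ) :
    HasDerivAt (waveDamped ε) (waveReal x * (-(3 / 2) * (x * (1 + x ^ 2)⁻¹) * (1 + ε * x ^ 2)⁻¹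
      - 2 * ε * x * ((1 + ε * x ^ 2)⁻¹) ^ 2)) x := by
  have h0 : 1 + ε * x ^ 2 ≠ 0 := by positivity
  have h1 : HasDerivAt (fun x : ℝ => (1 + ε * x ^ 2)⁻¹) (-(ε * (2 * x)) / (1 + ε * x ^ 2) ^ 2) x := by
    have h2 : HasDerivAt (fun x : ℝ => 1 + ε * x ^ 2) (ε * (2 * x)) x := by
      simpa using ((hasDerivAt_pow 2 x).const_mul ε).const_add 1
    exact h2.inv h0
  refine ((hasDerivAt_waveReal x).mul h1).congr_deriv ?_
  have h3 : (1 + x ^ 2) ^ (-(7 / 4) : ℝ) = (1 + x ^ 2) ^ (-(3 / 4) : ℝ) * (1 + x ^ 2)⁻¹ := by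
    rw [← Real.rpow_neg_one, ← Real.rpow_add (by positivity)]
    norm_num
  rw [h3, waveReal]
  field_simp
  ring

theorem continuous_waveReal : Continuous waveReal :=
  continuous_const.mul (continuous_bracket _)

theorem bracket_three_halves_le {ε η : ℝ} (hε : 0 < ε) (hε1 : ε ≤ 1) (hη : 0 ≤ η) (hη1 : η ≤ 1)
    (x : ℝ) : (1 + x ^ 2) ^ (-(3 / 2) : ℝ) ≤ ε ^ (-η) * (1 + x ^ 2) ^ (-(1 / 2 + η)) := by
  refine (bracket_le_bracket (s := 1 / 2 + η) (by linarith) x).trans ?_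
  refine le_mul_of_one_le_left (by positivity) ?_
  exact Real.one_le_rpow_of_pos_of_le_one_of_nonpos hε hε1 (by linarith)

/-- The undamped x²f² is only O((1+x²)^{-1/2}), just short of integrable. Damping supplies the
missing η, through (1+εx²)^{-2} ≤ (1+εx²)^{-η} ≤ (ε(1+x²))^{-η}. -/
theorem sq_mul_waveDamped_le {ε η : ℝ} (hε : 0 < ε) (hε1 : ε ≤ 1) (hη : 0 ≤ η) (hη1 : η ≤ 1)
    (x : ℝ) : (x * waveDamped ε x) ^ 2 ≤ ε ^ (-η) * (1 + x ^ 2) ^ (-(1 / 2 + η)) := by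
  have hb : (0 : ℝ) < 1 + x ^ 2 := by positivity
  have he : (0 : ℝ) < 1 + ε * x ^ 2 := by positivity
  have h1 : ((1 + ε * x ^ 2)⁻¹) ^ 2 ≤ ε ^ (-η) * (1 + x ^ 2) ^ (-η) := by
    rw [← Real.mul_rpow hε.le hb.le, ← Real.rpow_natCast, Real.inv_rpow he.le, ← Real.rpow_neg he.le]
    refine (Real.rpow_le_rpow_of_exponent_le (y := -(((2 : ℕ) : ℝ))) (z := -η) ?_ ?_).trans
      (Real.rpow_le_rpow_of_nonpos (by positivity) ?_ (by linarith))
    · nlinarith [sq_nonneg x]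
    · push_cast; linarith
    · nlinarith
  have h2 : x ^ 2 * (1 + x ^ 2) ^ (-(3 / 2) : ℝ) ≤ (1 + x ^ 2) ^ (-(1 / 2) : ℝ) := by
    have h : (1 + x ^ 2) ^ (-(1 / 2) : ℝ) = (1 + x ^ 2) * (1 + x ^ 2) ^ (-(3 / 2) : ℝ) := by
      rw [← Real.rpow_one_add' hb.le (by norm_num)]
      norm_num
    rw [h]
    gcongr
    linarith
  have h3 : (1 + x ^ 2) ^ (-(1 / 2 + η)) = (1 + x ^ 2) ^ (-(1 / 2) : ℝ) * (1 + x ^ 2) ^ (-η) := by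
    rw [← Real.rpow_add hb]
    congr 1
    ring
  calc (x * waveDamped ε x) ^ 2
      = 1 / 2 * (x ^ 2 * (1 + x ^ 2) ^ (-(3 / 2) : ℝ)) * ((1 + ε * x ^ 2)⁻¹) ^ 2 := by
        rw [waveDamped, mul_pow, mul_pow, waveReal_sq]
        ring
    _ ≤ 1 * (1 + x ^ 2) ^ (-(1 / 2) : ℝ) * (ε ^ (-η) * (1 + x ^ 2) ^ (-η)) := by
        gcongr
        norm_num
    _ = _ := by rw [h3]; ring

theorem deriv_waveDamped_sq_le {ε η : ℝ} (hε : 0 < ε) (hε1 : ε ≤ 1) (hη : 0 ≤ η) (hη1 : η ≤ 1)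
    (x : ℝ) : deriv (waveDamped ε) x ^ 2 ≤ 2 * (ε ^ (-η) * (1 + x ^ 2) ^ (-(1 / 2 + η))) := by
  have he : (0 : ℝ) < 1 + ε * x ^ 2 := by positivity
  have h1 : |x * (1 + x ^ 2)⁻¹| ≤ 1 / 2 := by
    rw [abs_mul, abs_of_pos (a := (1 + x ^ 2)⁻¹) (by positivity), ← div_eq_mul_inv,
      div_le_iff₀ (by positivity), ← sq_abs]
    nlinarith [sq_nonneg (|x| - 1)]
  have h2 : |(1 + ε * x ^ 2)⁻¹| ≤ 1 := by
    rw [abs_of_pos (by positivity)]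
    exact inv_le_one_of_one_le₀ (by nlinarith [sq_nonneg x])
  -- 2ε|x| ≤ ε(1 + x²) ≤ 1 + εx² ≤ (1 + εx²)², where ε ≤ 1 is used.
  have h3 : |2 * ε * x * ((1 + ε * x ^ 2)⁻¹) ^ 2| ≤ 1 := by
    rw [abs_mul, abs_of_pos (a := ((1 + ε * x ^ 2)⁻¹) ^ 2) (by positivity), inv_pow,
      ← div_eq_mul_inv, div_le_one (by positivity), abs_mul, abs_of_pos (a := 2 * ε) (by positivity)]
    nlinarith [sq_nonneg (|x| - 1), sq_abs x, sq_nonneg (ε * x ^ 2), mul_pos hε hε,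
      mul_nonneg hε.le (sq_nonneg (|x| - 1))]
  have hK : |-(3 / 2) * (x * (1 + x ^ 2)⁻¹) * (1 + ε * x ^ 2)⁻¹
      - 2 * ε * x * ((1 + ε * x ^ 2)⁻¹) ^ 2| ≤ 2 := by
    refine (abs_sub _ _).trans ?_
    have h4 : |-(3 / 2) * (x * (1 + x ^ 2)⁻¹) * (1 + ε * x ^ 2)⁻¹| ≤ 3 / 2 * (1 / 2) * 1 := by
      rw [abs_mul, abs_mul]
      gcongr
      rw [abs_neg, abs_of_pos (by norm_num)]
    linarith
  rw [(hasDerivAt_waveDamped hε x).deriv, mul_pow, waveReal_sq]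
  have h5 := sq_le_sq.2 (hK.trans (le_abs_self 2))
  calc _ ≤ 1 / 2 * (1 + x ^ 2) ^ (-(3 / 2) : ℝ) * 2 ^ 2 := by gcongr
    _ ≤ 1 / 2 * (ε ^ (-η) * (1 + x ^ 2) ^ (-(1 / 2 + η))) * 2 ^ 2 := by
        gcongr
        exact bracket_three_halves_le hε hε1 hη hη1 x
    _ = _ := by ring

/-- The removed fraction u satisfies both u ≤ 1 and u ≤ ε(1+x²), so u² ≤ u^{1-η} ≤ (ε(1+x²))^{1-η}.
-/
theorem waveTail_sq_le {ε η : ℝ} (hε : 0 < ε) (hη : 0 ≤ η) (hη1 : η ≤ 1) (x : ℝ) :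
    waveTail ε x ^ 2 ≤ ε ^ (1 - η) * (1 + x ^ 2) ^ (-(1 / 2 + η)) := by
  have hb : (0 : ℝ) < 1 + x ^ 2 := by positivity
  have he : (0 : ℝ) < 1 + ε * x ^ 2 := by positivity
  set u := ε * x ^ 2 * (1 + ε * x ^ 2)⁻¹ with hu
  have hu0 : 0 ≤ u := by positivity
  have hu1 : u ≤ 1 := by
    rw [hu, ← div_eq_mul_inv, div_le_one he]
    linarith
  have hu2 : u ≤ ε * (1 + x ^ 2) := by
    rw [hu, ← div_eq_mul_inv, div_le_iff₀ he]
    nlinarith [sq_nonneg x, mul_pos hε hε, mul_nonneg hε.le (sq_nonneg x),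
      mul_nonneg (mul_nonneg hε.le hb.le) (mul_nonneg hε.le (sq_nonneg x))]
  have h1 : u ^ 2 ≤ ε ^ (1 - η) * (1 + x ^ 2) ^ (1 - η) := by
    rw [← Real.mul_rpow hε.le hb.le, ← Real.rpow_natCast]
    refine (Real.rpow_le_rpow_of_exponent_ge' hu0 hu1 (z := 1 - η) (by linarith) ?_).trans
      (Real.rpow_le_rpow hu0 hu2 (by linarith))
    push_cast
    linarith
  have h3 : (1 + x ^ 2) ^ (-(1 / 2 + η)) = (1 + x ^ 2) ^ (-(3 / 2) : ℝ) * (1 + x ^ 2) ^ (1 - η) := by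
    rw [← Real.rpow_add hb]
    congr 1
    ring
  calc waveTail ε x ^ 2 = 1 / 2 * (1 + x ^ 2) ^ (-(3 / 2) : ℝ) * u ^ 2 := by
        rw [waveTail, mul_pow, waveReal_sq]
    _ ≤ 1 * (1 + x ^ 2) ^ (-(3 / 2) : ℝ) * (ε ^ (1 - η) * (1 + x ^ 2) ^ (1 - η)) := by
        gcongr
        norm_num
    _ = _ := by rw [h3]; ring

theorem memLp_waveReal : MemLp waveReal 2 := by
  refine memLp_two_of_sq_le continuous_waveReal.aestronglyMeasurable
    ((integrable_bracket (s := 3 / 2) (by norm_num)).const_mul (1 / 2)) fun x => ?_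
  rw [waveReal_sq]

theorem continuous_waveDamped {ε : ℝ} (hε : 0 < ε) : Continuous (waveDamped ε) :=
  continuous_iff_continuousAt.2 fun x => (hasDerivAt_waveDamped hε x).continuousAt

theorem inLadderDomain_waveDamped {ε : ℝ} (hε : 0 < ε) (hε1 : ε ≤ 1) :
    InLadderDomain (waveDamped ε) := by
  have hi := (integrable_bracket (s := 1 / 2 + 1) (by norm_num)).const_mul (ε ^ (-1 : ℝ))
  refine ⟨fun x => (hasDerivAt_waveDamped hε x).differentiableAt, ?_, ?_, ?_⟩
  · refine memLp_two_of_sq_le (continuous_waveDamped hε).aestronglyMeasurable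
      memLp_waveReal.integrable_sq fun x => ?_
    rw [waveDamped, mul_pow]
    refine mul_le_of_le_one_right (sq_nonneg _) (pow_le_one₀ (by positivity) ?_)
    exact inv_le_one_of_one_le₀ (by nlinarith [sq_nonneg x])
  · exact memLp_two_of_sq_le (continuous_id.mul (continuous_waveDamped hε)).aestronglyMeasurable
      hi fun x => sq_mul_waveDamped_le hε hε1 zero_le_one le_rfl x
  · exact memLp_two_of_sq_le (measurable_deriv _).aestronglyMeasurable
      (hi.const_mul 2) fun x => deriv_waveDamped_sq_le hε hε1 zero_le_one le_rfl x

theorem creation_waveDamped_sq_le {ε η : ℝ} (hε : 0 < ε) (hε1 : ε ≤ 1) (hη : 0 ≤ η) (hη1 : η ≤ 1)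
    (x : ℝ) : creation (waveDamped ε) x ^ 2
      ≤ 3 * (ε ^ (-η) * (1 + x ^ 2) ^ (-(1 / 2 + η))) := by
  have h1 := sq_mul_waveDamped_le hε hε1 hη hη1 x
  have h2 := deriv_waveDamped_sq_le hε hε1 hη hη1 x
  rw [creation, div_pow, Real.sq_sqrt zero_le_two]
  nlinarith [sq_nonneg (x * waveDamped ε x + deriv (waveDamped ε) x)]

theorem memLp_waveTail {ε : ℝ} (hε : 0 < ε) : MemLp (waveTail ε) 2 := by
  have hc : Continuous (waveTail ε) := by
    have h : Continuous fun x => waveReal x - waveDamped ε x :=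
      continuous_waveReal.sub (continuous_waveDamped hε)
    convert! h using 1
    funext x
    linarith [waveDamped_add_waveTail hε x]
  exact memLp_two_of_sq_le hc.aestronglyMeasurable
    ((integrable_bracket (s := 1 / 2 + 1) (by norm_num)).const_mul (ε ^ (1 - 1 : ℝ)))
    fun x => waveTail_sq_le hε zero_le_one le_rfl x

theorem waveVec_eq_add {ε : ℝ} (hε : 0 < ε) (hε1 : ε ≤ 1) :
    waveVec = realVec (inLadderDomain_waveDamped hε hε1).memLp + realVec (memLp_waveTail hε) := by
  refine Lp.ext ?_
  filter_upwards [memLp_waveFun.coeFn_toLp, coeFn_realVec (inLadderDomain_waveDamped hε hε1).memLp,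
    coeFn_realVec (memLp_waveTail hε), Lp.coeFn_add
      (realVec (inLadderDomain_waveDamped hε hε1).memLp) (realVec (memLp_waveTail hε))]
    with x h1 h2 h3 h4
  rw [h4, Pi.add_apply, h2, h3, waveVec, h1, waveFun_eq, ← waveDamped_add_waveTail hε x]
  push_cast
  rfl

/-- The minimum is bounded by ε(n+1) on the damped part and by 1 on the tail. Both contribute order
ε^{1-η}, since ε · ε^{-η} = ε^{1-η}; the constant is 8 = 2 · 3 + 2 · 1, the factors 2 coming from
|a+b|² ≤ 2|a|² + 2|b|². -/
theorem tsum_min_mul_fockCoeff_waveVec_le {ε η : ℝ} (hε : 0 < ε) (hε1 : ε ≤ 1) (hη : 0 ≤ η)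
    (hη1 : η ≤ 1) :
    ∑' n : ℕ, min 1 (ENNReal.ofReal (ε * ((n : ℝ) + 1))) * ‖fockCoeff n waveVec‖ₑ ^ 2
      ≤ ENNReal.ofReal (ε ^ (1 - η)) *
        (8 * ∫⁻ x : ℝ, ENNReal.ofReal ((1 + x ^ 2) ^ (-(1 / 2 + η)))) := by
  set C := ∫⁻ x : ℝ, ENNReal.ofReal ((1 + x ^ 2) ^ (-(1 / 2 + η))) with hC
  set d := realVec (inLadderDomain_waveDamped hε hε1).memLp with hd
  set t := realVec (memLp_waveTail hε) with ht
  have hm : Measurable fun x : ℝ => ENNReal.ofReal ((1 + x ^ 2) ^ (-(1 / 2 + η))) := by fun_prop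
  have hE : ∑' n : ℕ, ENNReal.ofReal ((n : ℝ) + 1) * ‖fockCoeff n d‖ₑ ^ 2
      ≤ ENNReal.ofReal (3 * ε ^ (-η)) * C := by
    refine (tsum_mul_enorm_fockCoeff_sq_le (inLadderDomain_waveDamped hε hε1)).trans ?_
    rw [hC, ← lintegral_const_mul _ hm]
    refine lintegral_mono fun x => ?_
    rw [← ENNReal.ofReal_mul (by positivity), mul_assoc]
    exact ENNReal.ofReal_le_ofReal (creation_waveDamped_sq_le hε hε1 hη hη1 x)
  have hT : ∑' n : ℕ, ‖fockCoeff n t‖ₑ ^ 2 ≤ ENNReal.ofReal (ε ^ (1 - η)) * C := by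
    refine (tsum_enorm_fockCoeff_sq_le t).trans ?_
    rw [ht, enorm_realVec_sq, hC, ← lintegral_const_mul _ hm]
    refine lintegral_mono fun x => ?_
    rw [← ENNReal.ofReal_mul (by positivity)]
    exact ENNReal.ofReal_le_ofReal (waveTail_sq_le hε hη hη1 x)
  have hterm : ∀ n : ℕ, min 1 (ENNReal.ofReal (ε * ((n : ℝ) + 1))) * ‖fockCoeff n waveVec‖ₑ ^ 2
      ≤ 2 * ENNReal.ofReal ε * (ENNReal.ofReal ((n : ℝ) + 1) * ‖fockCoeff n d‖ₑ ^ 2)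
        + 2 * ‖fockCoeff n t‖ₑ ^ 2 := by
    intro n
    rw [waveVec_eq_add hε hε1, fockCoeff_add]
    have h1 : ‖fockCoeff n d + fockCoeff n t‖ₑ ^ 2
        ≤ 2 * ‖fockCoeff n d‖ₑ ^ 2 + 2 * ‖fockCoeff n t‖ₑ ^ 2 := by
      simp only [← ofReal_norm, ← ENNReal.ofReal_pow (norm_nonneg _)]
      rw [← ENNReal.ofReal_ofNat 2, ← ENNReal.ofReal_mul zero_le_two,
        ← ENNReal.ofReal_mul zero_le_two, ← ENNReal.ofReal_add (by positivity) (by positivity)]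
      refine ENNReal.ofReal_le_ofReal ?_
      have h2 := norm_add_le (fockCoeff n d) (fockCoeff n t)
      nlinarith [sq_nonneg (‖fockCoeff n d‖ - ‖fockCoeff n t‖), norm_nonneg (fockCoeff n d),
        norm_nonneg (fockCoeff n t), norm_nonneg (fockCoeff n d + fockCoeff n t)]
    refine (mul_le_mul_right h1 _).trans ?_
    rw [mul_add]
    refine add_le_add ?_ ?_
    · refine (mul_le_mul_left (min_le_right _ _) _).trans (le_of_eq ?_)
      rw [ENNReal.ofReal_mul hε.le]
      ring
    · exact mul_le_of_le_one_left zero_le (min_le_left _ _)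
  calc _ ≤ ∑' n : ℕ, (2 * ENNReal.ofReal ε * (ENNReal.ofReal ((n : ℝ) + 1) * ‖fockCoeff n d‖ₑ ^ 2)
        + 2 * ‖fockCoeff n t‖ₑ ^ 2) := ENNReal.tsum_le_tsum hterm
    _ ≤ 2 * ENNReal.ofReal ε * (ENNReal.ofReal (3 * ε ^ (-η)) * C)
        + 2 * (ENNReal.ofReal (ε ^ (1 - η)) * C) := by
        rw [ENNReal.tsum_add, ENNReal.tsum_mul_left, ENNReal.tsum_mul_left]
        gcongr
    _ = _ := by
        have h1 : ENNReal.ofReal ε * ENNReal.ofReal (3 * ε ^ (-η))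
            = 3 * ENNReal.ofReal (ε ^ (1 - η)) := by
          rw [← ENNReal.ofReal_ofNat 3, ← ENNReal.ofReal_mul hε.le, ← ENNReal.ofReal_mul (by norm_num)]
          congr 1
          rw [sub_eq_add_neg, Real.rpow_add hε, Real.rpow_one]
          ring
        rw [mul_assoc 2, ← mul_assoc (ENNReal.ofReal ε), h1]
        ring

theorem powForm_waveVec_lt_top {r : ℝ} (hr : r < 1) : powForm r waveVec < ∞ := by
  -- Negative exponents are dominated by r = 0 because n + 1 ≥ 1. With η = (1-r′)/2 the decay
  -- exponent s = 1 - η exceeds r′, and η > 0 makes the constant finite.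
  set r' := max r 0 with hr'
  have h0 : 0 ≤ r' := le_max_right _ _
  have h1 : r' < 1 := max_lt hr one_pos
  have hη : 0 < (1 - r') / 2 := by linarith
  refine lt_of_le_of_lt ?_ (tsum_rpow_mul_lt_top (a := fun n => ‖fockCoeff n waveVec‖ₑ ^ 2)
    (C := 8 * ∫⁻ x : ℝ, ENNReal.ofReal ((1 + x ^ 2) ^ (-(1 / 2 + (1 - r') / 2)))) ?_ h0
    (s := 1 - (1 - r') / 2) (by linarith) fun ε hε hε1 =>
      tsum_min_mul_fockCoeff_waveVec_le hε hε1 hη.le (by linarith))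
  · refine ENNReal.tsum_le_tsum fun n => ?_
    gcongr
    · linarith [n.cast_nonneg (α := ℝ)]
    · exact le_max_left _ _
  · exact ENNReal.mul_ne_top (by simp)
      (integrable_bracket (s := 1 / 2 + (1 - r') / 2) (by linarith)).lintegral_lt_top.ne

theorem moment_waveVec (k : ℝ) : moment k (pureState waveVec) = powForm (k / 2) waveVec :=
  expected_pureState norm_waveVec fun _ φ hc => powForm_smul _ hc φ

end QCLT

end

/-! ### The counterexample to a central limit theorem with weaker moments -/

theorem mainTheorem9 :
    -- `ψ_f` is a state, and so are all its convolutions `ψ_f^{⊞ n}`, `n ≥ 1`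
    QCLT.IsState (QCLT.pureState QCLT.waveVec) ∧
    (∀ n : ℕ, 1 ≤ n → QCLT.IsState (QCLT.convPow (QCLT.pureState QCLT.waveVec) n)) ∧
    -- (a)
    QCLT.IsCentred (QCLT.pureState QCLT.waveVec) ∧
    -- (b)
    (∀ δ : ℝ, 0 < δ →
      QCLT.moment (2 * (1 - δ)) (QCLT.pureState QCLT.waveVec) = QCLT.powForm (1 - δ) QCLT.waveVec ∧
      QCLT.powForm (1 - δ) QCLT.waveVec < ⊤) ∧
    -- (c)
    (¬ ∃ σ : QCLT.OneMode →L[ℂ] QCLT.OneMode, QCLT.IsState σ ∧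
      QCLT.ConvergesWeakly (QCLT.convPow (QCLT.pureState QCLT.waveVec)) σ) ∧
    -- finiteness of all moments of order less than `2` does not suffice for convergence
    (¬ ∀ ρ : QCLT.OneMode →L[ℂ] QCLT.OneMode, QCLT.IsState ρ → QCLT.IsCentred ρ →
      (∀ k : ℝ, k < 2 → QCLT.moment k ρ < ⊤) →
      ∃ σ : QCLT.OneMode →L[ℂ] QCLT.OneMode, QCLT.IsState σ ∧
        QCLT.ConvergesWeakly (QCLT.convPow ρ) σ) := by
  have hstate := (QCLT.isMixture_pureState QCLT.norm_waveVec).isState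
  have hdiv : ¬ ∃ σ : QCLT.OneMode →L[ℂ] QCLT.OneMode, QCLT.IsState σ ∧
      QCLT.ConvergesWeakly (QCLT.convPow (QCLT.pureState QCLT.waveVec)) σ := by
    rintro ⟨σ, hσ, h⟩
    exact QCLT.not_convergesWeakly_convPow QCLT.norm_waveVec QCLT.lintegral_sq_pureLaw_waveVec
      QCLT.map_neg_pureLaw_waveVec hσ h
  refine ⟨hstate, fun n hn => ?_, QCLT.isCentred_waveVec, fun δ hδ => ⟨?_, ?_⟩, hdiv, fun h => ?_⟩
  · obtain ⟨m, rfl⟩ := Nat.exists_eq_add_of_le' hn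
    obtain ⟨ι, v, hv, -⟩ := QCLT.exists_isMixture_convPow_charFun QCLT.norm_waveVec m
    exact hv.isState
  · rw [QCLT.moment_waveVec]
    congr 1
    ring
  · exact QCLT.powForm_waveVec_lt_top (by linarith)
  · refine hdiv (h _ hstate QCLT.isCentred_waveVec fun k hk => ?_)
    rw [QCLT.moment_waveVec]
    exact QCLT.powForm_waveVec_lt_top (by linarith)
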